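/- **Notation.** An index is a finite tuple $\boldsymbol{k}=(k_1,\dots,k_r)$ of positive integers; $r$ is its depth. It is admissible if it is empty or $k_r\ge 2$. For admissible $\boldsymbol{k}$ put $\zeta(\boldsymbol{k})=\sum_{0<n_1<\cdots<n_r}\frac{1}{n_1^{k_1}\cdots n_r^{k_r}}$, with $\zeta(\varnothing)=1$. Let $\mathcal{Z}\subset\mathbb{R}$ be the $\mathbb{Q}$-subalgebra generated by all these values and $\overline{\mathcal{Z}}=\mathcal{Z}/\zeta(2)\mathcal{Z}$. *The ring $\mathcal{A}_n$.* For a positive integer $n$, let $\mathcal{A}_n=\prod_p(\mathbb{Z}/p^n\mathbb{Z})\big/\bigoplus_p(\mathbb{Z}/p^n\mathbb{Z})$ with $p$ running over all primes, and define in $\mathcal{A}_n$ $$\zeta_{\mathcal{A}_n}(\boldsymbol{k})=\Bigl(\sum_{0<n_1<\cdots<n_r<p}\tfrac{1}{n_1^{k_1}\cdots n_r^{k_r}}\bmod p^n\Bigr)_p,\qquad \zeta^\star_{\mathcal{A}_n}(\boldsymbol{k})=\Bigl(\sum_{1\le n_1\le\cdots\le n_r\le p-1}\tfrac{1}{n_1^{k_1}\cdots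 n_r^{k_r}}\bmod p^n\Bigr)_p .$$ *Harmonic regularization.* Let $\mathfrak{H}^1$ be the $\mathbb{Q}$-vector space with basis the words $e_{\boldsymbol{k}}=e_{k_1}\cdots e_{k_r}$, $\boldsymbol{k}$ an index, with the bilinear harmonic product given by $w*1=1*w=w$ and $e_aw_1*e_bw_2=e_a(w_1*e_bw_2)+e_b(e_aw_1*w_2)+e_{a+b}(w_1*w_2)$, and let $\mathfrak{H}^0$ be the span of the $e_{\boldsymbol{k}}$ with $\boldsymbol{k}$ admissible. Every $a\in\mathfrak{H}^1$ is uniquely a finite sum $a=\sum_{i\ge0}a_i*e_1^{*i}$ with $a_i\in\mathfrak{H}^0$; put $\mathrm{reg}_*(a)=a_0$. Let $Z\colon\mathfrak{H}^0\to\mathcal{Z}$ be the linear map with $Z(e_{\boldsymbol{k}})=\zeta(\boldsymbol{k})$, and put $\zeta^*(\boldsymbol{k})=Z(\mathrm{reg}_*(e_{\boldsymbol{k}}))$ for every index $\boldsymbol{k}$. *The $\mathcal{S}_n$-values.* Let $\zeta_{\widehat{\mathcal{S}}}(\boldsymbol{k})\in\overline{\mathcal{Z}}[[t]]$ be the reduction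 modulo $\zeta(2)$ of $$\sum_{i=0}^r(-1)^{k_{i+1}+\cdots+k_r}\zeta^*(k_1,\dots,k_i)\sum_{l_{i+1},\dots,l_r\ge0}\Bigl[\prod_{j=i+1}^r\binom{k_j+l_j-1}{l_j}\Bigr]\zeta^*(k_r+l_r,\dots,k_{i+1}+l_{i+1})\,t^{l_{i+1}+\cdots+l_r},$$ and let $\zeta^\star_{\widehat{\mathcal{S}}}(\boldsymbol{k})=\sum\zeta_{\widehat{\mathcal{S}}}(k_1\square\cdots\square k_r)$, the sum being over all ways to replace each $\square$ by a comma or a plus sign. Finally, $\zeta_{\mathcal{S}_n}(\boldsymbol{k})$ and $\zeta^\star_{\mathcal{S}_n}(\boldsymbol{k})$ are the images of $\zeta_{\widehat{\mathcal{S}}}(\boldsymbol{k})$ and $\zeta^\star_{\widehat{\mathcal{S}}}(\boldsymbol{k})$ in $\overline{\mathcal{Z}}[[t]]/(t^n)$. **Theorem ($\mathcal{F}_n$-symmetric sum formula).** Let $n$ and $r$ be positive integers, $\boldsymbol{k}=(k_1,\dots,k_r)$ an index of depth $r$, and $\mathcal{F}\in\{\mathcal{A},\mathcal{S}\}$. Then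 $$\sum_{\sigma\in\mathfrak{S}_r}\zeta_{\mathcal{F}_n}(\sigma(\boldsymbol{k}))=\sum_{\mathcal{B}=\{B_1,\dots,B_l\}}(-1)^{r-l}c(\mathcal{B})\,\zeta_{\mathcal{F}_n}(b_1(\boldsymbol{k}))\cdots\zeta_{\mathcal{F}_n}(b_l(\boldsymbol{k})),$$ $$\sum_{\sigma\in\mathfrak{S}_r}\zeta^\star_{\mathcal{F}_n}(\sigma(\boldsymbol{k}))=\sum_{\mathcal{B}=\{B_1,\dots,B_l\}}c(\mathcal{B})\,\zeta_{\mathcal{F}_n}(b_1(\boldsymbol{k}))\cdots\zeta_{\mathcal{F}_n}(b_l(\boldsymbol{k})).$$ Here $\mathfrak{S}_r$ is the symmetric group, $\sigma(\boldsymbol{k})=(k_{\sigma(1)},\dots,k_{\sigma(r)})$, $\mathcal{B}=\{B_1,\dots,B_l\}$ runs over all partitions of the set $\{1,\dots,r\}$ into nonempty blocks, $c(\mathcal{B})=\prod_{i=1}^l(\#B_i-1)!$, and $b_i(\boldsymbol{k})=\sum_{j\in B_i}k_j$. -/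

import Mathlib

namespace FMZV

/-- An index: a finite tuple of positive integers (the empty index is `[]`). -/
abbrev Index := List ℕ+

/-! ### Multiple zeta values -/

/-- Admissible indices: the empty one, and those whose last entry is at least `2`. -/
def Admissible (k : Index) : Prop := ∀ a ∈ k.getLast?, 2 ≤ a

/-- The multiple zeta value `ζ(k₁,…,kᵣ) = ∑_{0 < n₁ < ⋯ < nᵣ} 1 / (n₁^k₁ ⋯ nᵣ^kᵣ)`; it is used
only for admissible `k`, where the series converges. -/
noncomputable def zeta (k : Index) : ℝ :=
  ∑' n : {n : Fin k.length → ℕ // StrictMono n ∧ ∀ i, 0 < n i},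
    ∏ i : Fin k.length, ((n.1 i : ℝ) ^ (k.get i : ℕ))⁻¹

/-- The `ℚ`-subalgebra of `ℝ` generated by all multiple zeta values. -/
noncomputable def MZVAlg : Subalgebra ℚ ℝ :=
  Algebra.adjoin ℚ {x : ℝ | ∃ k : Index, Admissible k ∧ x = zeta k}

/-- The multiple zeta value of an admissible index as an element of `MZVAlg`. -/
noncomputable def zetaZ (k : Index) (hk : Admissible k) : MZVAlg :=
  ⟨zeta k, Algebra.subset_adjoin ⟨k, hk, rfl⟩⟩

theorem admissible_two : Admissible [2] := by
  intro a ha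
  simp at ha
  exact ha.le

/-- The quotient of the algebra of multiple zeta values by the ideal generated by `ζ(2)`. -/
abbrev MZVBar : Type := MZVAlg ⧸ Ideal.span {zetaZ [2] admissible_two}

/-! ### The harmonic algebra and the harmonic regularization -/

/-- The space `𝔥¹ = ℚ + e₁ ℚ⟨e₀, e₁⟩`, whose `ℚ`-basis consists of the words
`e_k = e_{k₁} ⋯ e_{kᵣ}` (`k` an index), where `e_{a} = e₁ e₀^(a-1)`. -/
abbrev H1 : Type := Index →₀ ℚ

/-- The subspace `𝔥⁰ = ℚ + e₁ ℚ⟨e₀, e₁⟩ e₀`, spanned by `e_k` for `k` admissible. -/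
abbrev H0 : Submodule ℚ H1 := Finsupp.supported ℚ ℚ {k : Index | Admissible k}

/-- The word `e_k`. -/
noncomputable def word (k : Index) : H1 := Finsupp.single k 1

/-- Left concatenation by the letter `e_a`. -/
noncomputable def consL (a : ℕ+) : H1 →ₗ[ℚ] H1 := Finsupp.lmapDomain ℚ ℚ (fun w => a :: w)

/-- The harmonic (stuffle) product of two words. -/
noncomputable def harmWord : Index → Index → H1
  | [], w => word w
  | a :: v, [] => word (a :: v)
  | a :: v, b :: w =>
      consL a (harmWord v (b :: w)) + consL b (harmWord (a :: v) w) + consL (a + b) (harmWord v w)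
  termination_by v w => v.length + w.length

/-- The harmonic product on `𝔥¹`, extended `ℚ`-bilinearly from words. -/
noncomputable def harm : H1 →ₗ[ℚ] H1 →ₗ[ℚ] H1 :=
  Finsupp.linearCombination ℚ fun v => Finsupp.linearCombination ℚ fun w => harmWord v w

/-- The `i`-th power of `e₁` for the harmonic product. -/
noncomputable def e1Pow : ℕ → H1
  | 0 => word []
  | i + 1 => harm (word [1]) (e1Pow i)

open Classical in
/-- The harmonic regularization: every `a ∈ 𝔥¹` is uniquely a finite sum
`a = ∑ aᵢ * e₁^{*i}` with `aᵢ ∈ 𝔥⁰`, and the regularization of `a` is `a₀`. -/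
noncomputable def regHarm (a : H1) : H0 :=
  if h : ∃ p : ℕ →₀ H0, a = p.sum fun i b => harm (b : H1) (e1Pow i) then h.choose 0 else 0

/-- The `ℚ`-linear map on `𝔥⁰` with `e_k ↦ ζ(k)` for every admissible `k`. -/
noncomputable def evalH0 : H0 →ₗ[ℚ] MZVAlg :=
  (Finsupp.linearCombination ℚ fun k : {k : Index | Admissible k} => zetaZ k.1 k.2) ∘ₗ
    (Finsupp.supportedEquivFinsupp {k : Index | Admissible k}).toLinearMap

/-- The harmonic regularized multiple zeta value `ζ^*(k)`, for any index `k`. -/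
noncomputable def zetaReg (k : Index) : MZVAlg := evalH0 (regHarm (word k))

/-! ### `t`-adic symmetric multiple zeta values and `𝒮ₙ`-multiple zeta values -/

/-- The index `(k₁ + l₁, …, kₛ + lₛ)`. -/
def shift (k : Index) (l : Fin k.length → ℕ) : Index :=
  List.ofFn fun j => ⟨(k.get j : ℕ) + l j, Nat.add_pos_left (k.get j).pos _⟩

/-- For `k = (k₁, …, kₛ)`, the power series
`∑_{l₁, …, lₛ ≥ 0} ∏ⱼ binom(kⱼ + lⱼ - 1, lⱼ) ζ^*(kₛ + lₛ, …, k₁ + l₁) t^(l₁ + ⋯ + lₛ)`. -/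
noncomputable def shiftedSeries (k : Index) : PowerSeries MZVAlg :=
  PowerSeries.mk fun m => ∑ l ∈ Finset.Nat.antidiagonalTuple k.length m,
    ((∏ j, ((k.get j : ℕ) + l j - 1).choose (l j) : ℕ) : MZVAlg) * zetaReg (shift k l).reverse

/-- The harmonic version of the `t`-adic symmetric multiple zeta value, before reduction
modulo `ζ(2)`. -/
noncomputable def zetaSHatLift (k : Index) : PowerSeries MZVAlg :=
  ∑ i ∈ Finset.range (k.length + 1),
    PowerSeries.C ((-1 : MZVAlg) ^ ((k.drop i).map fun a : ℕ+ => (a : ℕ)).sum *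
      zetaReg (k.take i)) * shiftedSeries (k.drop i)

/-- The `t`-adic symmetric multiple zeta value. -/
noncomputable def zetaSHat (k : Index) : PowerSeries MZVBar :=
  PowerSeries.map (Ideal.Quotient.mk _) (zetaSHatLift k)

/-- All indices `(k₁ □ ⋯ □ kᵣ)` where each `□` is either a comma or a plus
(a list with `2^(r-1)` entries if `r ≥ 1`). -/
def contractions : Index → List Index
  | [] => [[]]
  | [a] => [[a]]
  | a :: b :: w => (contractions (b :: w)).map (fun v => a :: v) ++ contractions ((a + b) :: w)
  termination_by k => k.length

/-- The `t`-adic symmetric multiple zeta-star value. -/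
noncomputable def zetaStarSHat (k : Index) : PowerSeries MZVBar :=
  ((contractions k).map zetaSHat).sum

/-- The ring of power series in `t` over `MZVBar` modulo `t^n`. -/
abbrev SRing (n : ℕ) : Type :=
  PowerSeries MZVBar ⧸ Ideal.span {(PowerSeries.X : PowerSeries MZVBar) ^ n}

/-- The `𝒮ₙ`-multiple zeta value. -/
noncomputable def zetaS (n : ℕ) (k : Index) : SRing n := Ideal.Quotient.mk _ (zetaSHat k)

/-- The `𝒮ₙ`-multiple zeta-star value. -/
noncomputable def zetaStarS (n : ℕ) (k : Index) : SRing n := Ideal.Quotient.mk _ (zetaStarSHat k)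

/-! ### `𝒜ₙ`-multiple zeta values -/

/-- The ideal `⨁_p ℤ/pⁿ` of `∏_p ℤ/pⁿ`: families with finitely many nonzero components. -/
def finIdeal (n : ℕ) : Ideal (∀ p : Nat.Primes, ZMod ((p : ℕ) ^ n)) where
  carrier := {x | {p | x p ≠ 0}.Finite}
  add_mem' := by
    intro a b ha hb
    refine (ha.union hb).subset fun p hp => ?_
    by_contra h
    simp only [Set.mem_union, Set.mem_ofPred_eq, not_or, not_not] at h
    exact hp (by simp [h.1, h.2])
  zero_mem' := by simp
  smul_mem' := by
    intro c x hx
    refine hx.subset fun p hp h => hp ?_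
    simp [h]

/-- The ring `𝒜ₙ = (∏_p ℤ/pⁿ) / (⨁_p ℤ/pⁿ)`. -/
abbrev ARing (n : ℕ) : Type := (∀ p : Nat.Primes, ZMod ((p : ℕ) ^ n)) ⧸ finIdeal n

/-- The term `1 / (m₁^k₁ ⋯ mᵣ^kᵣ)` in `ℤ/N`; it is used only for `mᵢ` invertible modulo `N`. -/
def modTerm (N : ℕ) (k : Index) (m : Fin k.length → ℕ) : ZMod N :=
  ∏ i, ((m i : ZMod N) ^ (k.get i : ℕ))⁻¹

open Classical in
/-- The `𝒜ₙ`-multiple zeta value: the class of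
`(∑_{0 < m₁ < ⋯ < mᵣ < p} 1 / (m₁^k₁ ⋯ mᵣ^kᵣ) mod pⁿ)_p`. -/
noncomputable def zetaA (n : ℕ) (k : Index) : ARing n :=
  Ideal.Quotient.mk _ fun p => ∑ m ∈ (Fintype.piFinset fun _ : Fin k.length =>
    Finset.Ioo 0 (p : ℕ)).filter (fun m => StrictMono m), modTerm ((p : ℕ) ^ n) k m

open Classical in
/-- The `𝒜ₙ`-multiple zeta-star value: the class of
`(∑_{1 ≤ m₁ ≤ ⋯ ≤ mᵣ ≤ p - 1} 1 / (m₁^k₁ ⋯ mᵣ^kᵣ) mod pⁿ)_p`. -/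
noncomputable def zetaStarA (n : ℕ) (k : Index) : ARing n :=
  Ideal.Quotient.mk _ fun p => ∑ m ∈ (Fintype.piFinset fun _ : Fin k.length =>
    Finset.Icc 1 ((p : ℕ) - 1)).filter (fun m => Monotone m), modTerm ((p : ℕ) ^ n) k m

/-! ### Set partitions -/

/-- `c(B) = ∏ᵢ (#Bᵢ - 1)!` for a set partition `B` of the `r` positions. -/
def partCoeff {r : ℕ} (P : Finpartition (Finset.univ : Finset (Fin r))) : ℕ :=
  ∏ B ∈ P.parts, Nat.factorial (B.card - 1)

/-- `∑_{j ∈ B} kⱼ` as a positive integer, for a nonempty block `B`. -/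
def blockSum {r : ℕ} (k : Fin r → ℕ+) (B : Finset (Fin r)) (hB : B.Nonempty) : ℕ+ :=
  ⟨∑ j ∈ B, (k j : ℕ), Finset.sum_pos (fun j _ => (k j).pos) hB⟩

/-- `f(b₁(k)) ⋯ f(b_l(k))`, the product over the blocks `Bᵢ` of a set partition of the values of
`f` at the index of depth one formed by `bᵢ(k) = ∑_{j ∈ Bᵢ} kⱼ`. -/
def blockProd {R : Type} [CommRing R] (f : Index → R) {r : ℕ} (k : Fin r → ℕ+)
    (P : Finpartition (Finset.univ : Finset (Fin r))) : R :=
  ∏ B ∈ P.parts.attach, f [blockSum k B.1 (P.nonempty_of_mem_parts B.2)]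

end FMZV

/-! Everything rests on one product rule, that with an index of depth one (`IsStuffle`): f(a) f(k)
is the sum of f over all ways to insert a into k or to add a to an entry of k. Apply it with a = k_1
to every permutation of the tail k_2, …, k_r. The insertions run exactly once through the
permutations of the whole index, which gives a recursion (`permSum_succ`): the symmetric sum is
f(k_1) times that of the tail, minus the symmetric sums of the tails in which k_1 has been added to
one entry. The sum over set partitions obeys the same recursion (`partitionSum_insert`): the first
element is a block by itself or joins a block B, and the second contribution splits evenly among the
#B ways to add k_1 to an entry of B, because (#B)! = #B (#B-1)!. For star values the merged terms of
the product rule change sign (`starSum_insertSum`), so the signs disappear from the formula. A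
parameter ε, equal to -1 without star and 1 with star, treats both cases at once.

It remains to prove the product rule. Truncated sums over any finite list of values satisfy it
(`isStuffle_qsum`), which settles 𝒜_n prime by prime. For 𝒮_n, take the list 1, 1/2, …, 1/N,
1/(t-N), …, 1/(t-1) of power series. Cutting an index according to the two halves of this list
reproduces the definition of the 𝒮-value, with truncated sums in place of regularized values. A
truncated sum is a polynomial in the harmonic number H_N up to an error smaller than every power of
1/H_N, and the constant term of that polynomial is ζ^* (`regLim_zetaReg`). Passing to this constant
term is well defined and multiplicative (`RegLim.unique`, `RegLim.mul`), so the product rule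
survives in the limit (`isStuffle_zetaSHatReal`), even before reduction modulo ζ(2). -/

namespace FMZV

/-! ### Truncated sums over lists -/

section Truncated

variable {R : Type*} [CommRing R]

/-- The monomial quasi-symmetric function of index `k` at the list of values `s`:
the sum of `x₁^k₁ ⋯ xᵣ^kᵣ` over the sublists `(x₁, …, xᵣ)` of `s`. -/
def qsum : List R → Index → R
  | _, [] => 1
  | [], _ :: _ => 0
  | x :: s, a :: w => qsum s (a :: w) + x ^ (a : ℕ) * qsum s w

/-- The variant of `qsum` in which values may be repeated. -/
def qsumStar : List R → Index → R
  | _, [] => 1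
  | [], _ :: _ => 0
  | x :: s, a :: w => qsumStar s (a :: w) + x ^ (a : ℕ) * qsumStar (x :: s) w
  termination_by s k => s.length + k.length

@[simp] theorem qsum_nil_right (s : List R) : qsum s [] = 1 := by cases s <;> rfl

@[simp] theorem qsum_nil_cons (a : ℕ+) (w : Index) : qsum ([] : List R) (a :: w) = 0 := rfl

theorem qsum_cons_cons (x : R) (s : List R) (a : ℕ+) (w : Index) :
    qsum (x :: s) (a :: w) = qsum s (a :: w) + x ^ (a : ℕ) * qsum s w := rfl

@[simp] theorem qsumStar_nil_right (s : List R) : qsumStar s [] = 1 := by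
  cases s <;> simp [qsumStar]

@[simp] theorem qsumStar_nil_cons (a : ℕ+) (w : Index) : qsumStar ([] : List R) (a :: w) = 0 := by
  simp [qsumStar]

theorem qsumStar_cons_cons (x : R) (s : List R) (a : ℕ+) (w : Index) :
    qsumStar (x :: s) (a :: w) =
      qsumStar s (a :: w) + x ^ (a : ℕ) * qsumStar (x :: s) w := by
  rw [qsumStar]

theorem map_qsum {S : Type*} [CommRing S] (φ : R →+* S) (s : List R) (k : Index) :
    φ (qsum s k) = qsum (s.map φ) k := by
  induction s generalizing k with
  | nil => cases k <;> simp
  | cons x s ih => cases k <;> simp [qsum_cons_cons, ih]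

/-- The truncated sum over a concatenated list, by deconcatenation of the index. -/
theorem qsum_append (s s' : List R) (k : Index) :
    qsum (s ++ s') k =
      ∑ i ∈ Finset.range (k.length + 1), qsum s (k.take i) * qsum s' (k.drop i) := by
  induction s generalizing k with
  | nil =>
    cases k with
    | nil => simp
    | cons a w =>
      rw [List.length_cons, Finset.sum_range_succ']
      simp
  | cons x s ih =>
    cases k with
    | nil => simp
    | cons a w =>
      rw [List.cons_append, qsum_cons_cons, ih, ih, List.length_cons, Finset.sum_range_succ',
        Finset.sum_range_succ' _ (w.length + 1)]
      simp only [List.take_succ_cons, List.drop_succ_cons, qsum_cons_cons, add_mul,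
        Finset.sum_add_distrib, Finset.mul_sum, List.take_zero, qsum_nil_right, mul_assoc]
      ring

/-- The recursion at the last value; it describes how truncated zeta sums grow with the truncation
bound. -/
theorem qsum_concat (s : List R) (x : R) (k : Index) (a : ℕ+) :
    qsum (s ++ [x]) (k ++ [a]) = qsum s (k ++ [a]) + x ^ (a : ℕ) * qsum s k := by
  induction s generalizing k with
  | nil =>
    cases k with
    | nil => simp [qsum_cons_cons]
    | cons b w => cases w <;> simp [qsum_cons_cons]
  | cons y s ih =>
    cases k with
    | nil =>
      have := ih []
      simp only [List.nil_append, List.cons_append, qsum_cons_cons, qsum_nil_right] at *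
      rw [this]; ring
    | cons b w =>
      have h1 := ih (b :: w)
      have h2 := ih w
      simp only [List.cons_append, qsum_cons_cons] at *
      rw [h1, h2]; ring

/-! ### The product with an index of depth one -/

/-- The sum of `f` over all ways of inserting the letter `a` in an index, plus `ε` times the sum
of `f` over all ways of adding `a` to an entry of the index. -/
def insertSum (ε : R) (a : ℕ+) : (Index → R) → Index → R
  | f, [] => f [a]
  | f, b :: w => f (a :: b :: w) + ε * f ((a + b) :: w) + insertSum ε a (fun v => f (b :: v)) w

theorem insertSum_nil (ε : R) (a : ℕ+) (f : Index → R) : insertSum ε a f [] = f [a] := rfl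

theorem insertSum_cons (ε : R) (a : ℕ+) (f : Index → R) (b : ℕ+) (w : Index) :
    insertSum ε a f (b :: w) = f (a :: b :: w) + ε * f ((a + b) :: w) +
      insertSum ε a (fun v => f (b :: v)) w := rfl

theorem insertSum_add (ε : R) (a : ℕ+) (f g : Index → R) (k : Index) :
    insertSum ε a (fun v => f v + g v) k = insertSum ε a f k + insertSum ε a g k := by
  induction k generalizing f g with
  | nil => rfl
  | cons b w ih => simp only [insertSum_cons, ih]; ring

theorem insertSum_mul_left (ε : R) (a : ℕ+) (c : R) (f : Index → R) (k : Index) :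
    insertSum ε a (fun v => c * f v) k = c * insertSum ε a f k := by
  induction k generalizing f with
  | nil => rfl
  | cons b w ih => simp only [insertSum_cons, ih]; ring

theorem map_insertSum {S : Type*} [CommRing S] (φ : R →+* S) (ε : R) (a : ℕ+) (f : Index → R)
    (k : Index) : φ (insertSum ε a f k) = insertSum (φ ε) a (fun v => φ (f v)) k := by
  induction k generalizing f with
  | nil => rfl
  | cons b w ih => simp [insertSum_cons, ih]

/-- `f` is compatible with harmonic products with an index of depth one. -/
def IsStuffle (f : Index → R) : Prop :=
  ∀ a k, f [a] * f k = insertSum 1 a f k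

theorem IsStuffle.map {S : Type*} [CommRing S] {f : Index → R} (hf : IsStuffle f) (φ : R →+* S) :
    IsStuffle fun k => φ (f k) := by
  intro a k
  rw [← map_mul, hf, map_insertSum, map_one]

theorem insertSum_zero (ε : R) (a : ℕ+) (k : Index) : insertSum ε a (fun _ => 0) k = 0 := by
  simpa using insertSum_mul_left ε a 0 (fun _ => 0) k

/-- Prepending a value `x` creates three new products: x^a with the old sum, x^b with the old
product for the tail, and x^(a+b). They match inserting `a` before `b`, inserting or merging it
further right, and merging it with `b`. -/
theorem isStuffle_qsum (s : List R) : IsStuffle (qsum s) := by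
  induction s with
  | nil =>
    intro a k
    cases k with
    | nil => simp [insertSum_nil]
    | cons b w => simp [insertSum_cons, insertSum_zero]
  | cons x s ih =>
    intro a k
    cases k with
    | nil => simp [insertSum_nil]
    | cons b w =>
      have h1 := ih a (b :: w)
      have h2 := ih a w
      rw [insertSum_cons] at h1 ⊢
      simp only [qsum_cons_cons, insertSum_add, insertSum_mul_left, qsum_nil_right, ← h2,
        PNat.add_coe, pow_add] at h1 ⊢
      linear_combination h1

/-! ### Star values -/

/-- The sum of `f` over all indices obtained by contracting neighbouring entries. -/
def starSum (f : Index → R) (k : Index) : R := ((contractions k).map f).sum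

theorem starSum_nil (f : Index → R) : starSum f [] = f [] := by
  simp [starSum, contractions]

theorem starSum_singleton (f : Index → R) (a : ℕ+) : starSum f [a] = f [a] := by
  simp [starSum, contractions]

theorem starSum_cons_cons (f : Index → R) (a b : ℕ+) (w : Index) :
    starSum f (a :: b :: w) = starSum (fun v => f (a :: v)) (b :: w) + starSum f ((a + b) :: w) := by
  rw [starSum, contractions, List.map_append, List.sum_append, List.map_map]; rfl

theorem starSum_add (f g : Index → R) (k : Index) :
    starSum (fun v => f v + g v) k = starSum f k + starSum g k := by
  simp [starSum, List.sum_map_add]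

theorem starSum_mul_left (c : R) (f : Index → R) (k : Index) :
    starSum (fun v => c * f v) k = c * starSum f k := by
  simp [starSum, List.sum_map_mul_left]

theorem map_starSum {S : Type*} [CommRing S] (φ : R →+* S) (f : Index → R) (k : Index) :
    φ (starSum f k) = starSum (fun v => φ (f v)) k := by
  simp [starSum, map_list_sum, Function.comp_def]

/-- Summation over contractions intertwines the two signs of `insertSum`. -/
theorem starSum_insertSum (a : ℕ+) (f : Index → R) (k : Index) :
    starSum (insertSum 1 a f) k = insertSum (-1) a (starSum f) k := by
  -- Induction on the length, because the contraction `(b + c) :: w` is not a sublist of the index.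
  suffices H : ∀ n, ∀ k : Index, k.length = n → ∀ f : Index → R,
      starSum (insertSum 1 a f) k = insertSum (-1) a (starSum f) k from H _ k rfl f
  intro n
  induction n with
  | zero =>
    intro k hk f
    obtain rfl := List.length_eq_zero_iff.mp hk
    simp [starSum_nil, insertSum_nil, starSum_singleton]
  | succ n ih =>
    intro k hk f
    match k, hk with
    | [b], _ =>
      -- The source of the sign: the star values at (a, b) and at (b, a) each already contain f(a +
      -- b), which must count once.
      simp only [starSum_singleton, insertSum_cons, insertSum_nil, starSum_cons_cons, add_comm b a]
      ring
    | b :: c :: w, hk =>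
      have h1 := ih (c :: w) (by simpa using hk) (fun v => f (b :: v))
      have h2 := ih ((b + c) :: w) (by simpa using hk) f
      have h3 : insertSum 1 a f ∘ List.cons b = fun v => f (a :: b :: v) + f ((a + b) :: v) +
          insertSum 1 a (fun v => f (b :: v)) v := by
        ext v; simp [insertSum_cons]
      rw [starSum_cons_cons, h2, show (fun v => insertSum 1 a f (b :: v)) = _ from h3,
        starSum_add, starSum_add, h1]
      simp only [insertSum_cons, insertSum_add, starSum_cons_cons, add_comm b a, add_assoc,
        add_left_comm b a]
      ring

theorem IsStuffle.mul_starSum {f : Index → R} (hf : IsStuffle f) (a : ℕ+) (k : Index) :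
    f [a] * starSum f k = insertSum (-1) a (starSum f) k := by
  rw [← starSum_insertSum, ← starSum_mul_left]
  congr 1
  ext v
  exact hf a v

/-- A weakly increasing choice of values becomes strictly increasing once equal neighbours are
merged, and merging adds their exponents. -/
theorem starSum_qsum (s : List R) (k : Index) : starSum (qsum s) k = qsumStar s k := by
  induction s generalizing k with
  | nil =>
    cases k with
    | nil => simp [starSum_nil]
    | cons a w =>
      rw [qsumStar_nil_cons]
      induction w generalizing a with
      | nil => simp [starSum_singleton]
      | cons b w ih =>
        rw [starSum_cons_cons, ih,
          show (fun v => qsum ([] : List R) (a :: v)) = fun v => 0 * qsum ([] : List R) v by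
            ext; simp, starSum_mul_left]
        simp
  | cons x s ih =>
    have key : ∀ n, ∀ k : Index, k.length ≤ n →
        starSum (qsum (x :: s)) k = qsumStar (x :: s) k := by
      intro n
      induction n with
      | zero =>
        intro k hk
        obtain rfl := List.length_eq_zero_iff.mp (Nat.le_zero.mp hk)
        simp [starSum_nil]
      | succ n ihn =>
        intro k hk
        match k, hk with
        | [], _ => simp [starSum_nil]
        | [a], _ =>
          have := ih [a]
          rw [starSum_singleton] at *
          simp [qsumStar_cons_cons, qsum_cons_cons, this]
        | a :: b :: w, hk =>
          have h1 := ih (a :: b :: w)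
          have h2 := ihn (b :: w) (by simpa using hk)
          -- The contraction to a + b supplies the terms in which `x` is used for both of the first
          -- two entries.
          have h3 := ihn ((a + b) :: w) (by simpa using hk)
          have h4 := ih (b :: w)
          have h5 := ih ((a + b) :: w)
          rw [starSum_cons_cons] at h1 ⊢
          rw [qsumStar_cons_cons, ← h1, ← h2]
          rw [h3, qsumStar_cons_cons, ← h5]
          simp only [qsum_cons_cons, starSum_add, starSum_mul_left, h4, h2]
          have := ihn w (by simp at hk; omega)
          rw [qsumStar_cons_cons, PNat.add_coe, pow_add]
          ring
    exact key _ k le_rfl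

end Truncated

/-! ### Set partitions of a set with one more element -/

section Partitions

variable {α : Type*} [DecidableEq α]

/-- The parts of the set partition obtained from one with set of parts `𝒬` by adding the element
`x` to the block `B`; a new block `{x}` is created if `B` is empty. -/
def adjoinPart (x : α) (𝒬 : Finset (Finset α)) (B : Finset α) : Finset (Finset α) :=
  insert (insert x B) (𝒬.erase B)

/-- The set partition obtained by adding the element `x` to the block `B`, or as a new block if
`B` is empty. -/
def adjoinPartition {x : α} {s : Finset α} (hx : x ∉ s) (Q : Finpartition s) (B : Finset α)
    (hB : B ∈ insert ∅ Q.parts) : Finpartition (insert x s) :=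
  Finpartition.ofExistsUnique (adjoinPart x Q.parts B)
    (by
      intro p hp
      have hBs : B ⊆ s := by
        rcases Finset.mem_insert.mp hB with rfl | h
        · simp
        · exact Q.subset h
      rcases Finset.mem_insert.mp hp with rfl | h
      · exact Finset.insert_subset_insert _ hBs
      · exact (Q.subset (Finset.mem_of_mem_erase h)).trans (Finset.subset_insert _ _))
    (by
      intro y hy
      by_cases hyB : y = x ∨ y ∈ B
      · refine ⟨insert x B, ⟨by simp [adjoinPart], by simpa using hyB⟩, ?_⟩
        rintro t ⟨ht, hyt⟩
        rcases Finset.mem_insert.mp ht with rfl | h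
        · rfl
        · exfalso
          have htQ := Finset.mem_of_mem_erase h
          rcases hyB with rfl | hyB
          · exact hx (Q.subset htQ hyt)
          · rcases Finset.mem_insert.mp hB with rfl | hB
            · simp at hyB
            · exact Finset.ne_of_mem_erase h (Q.eq_of_mem_parts htQ hB hyt hyB)
      · push Not at hyB
        have hys : y ∈ s := by
          rcases Finset.mem_insert.mp hy with h | h
          · exact absurd h hyB.1
          · exact h
        obtain ⟨t, ⟨ht, hyt⟩, huniq⟩ := Q.existsUnique_mem hys
        refine ⟨t, ⟨Finset.mem_insert_of_mem (Finset.mem_erase.mpr ⟨?_, ht⟩), hyt⟩, ?_⟩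
        · rintro rfl
          exact hyB.2 hyt
        · rintro u ⟨hu, hyu⟩
          rcases Finset.mem_insert.mp hu with rfl | h
          · simp [hyB.1, hyB.2] at hyu
          · exact huniq u ⟨Finset.mem_of_mem_erase h, hyu⟩)
    (by
      intro h
      rcases Finset.mem_insert.mp h with h | h
      · exact Finset.insert_ne_empty _ _ h.symm
      · exact Q.empty_notMem_parts (Finset.mem_of_mem_erase h))

theorem parts_adjoinPartition {x : α} {s : Finset α} (hx : x ∉ s) (Q : Finpartition s)
    (B : Finset α) (hB : B ∈ insert ∅ Q.parts) :
    (adjoinPartition hx Q B hB).parts = adjoinPart x Q.parts B := rfl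

/-- This recovers the smaller partition from the larger one and `B`, as needed for injectivity. -/
theorem mem_parts_of_mem_adjoinPart {x : α} {s : Finset α} (hx : x ∉ s) (Q : Finpartition s)
    {B : Finset α} (hB : B ∈ insert ∅ Q.parts) {t : Finset α} :
    t ∈ Q.parts ↔ (t ∈ adjoinPart x Q.parts B ∧ x ∉ t) ∨ (t = B ∧ B ≠ ∅) := by
  have h0 := Q.empty_notMem_parts
  constructor
  · intro ht
    by_cases h : t = B
    · exact .inr ⟨h, by rintro rfl; exact h0 (h ▸ ht)⟩
    · exact .inl ⟨by simp [adjoinPart, h, ht], fun hxt => hx (Q.subset ht hxt)⟩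
  · rintro (⟨ht, hxt⟩ | ⟨rfl, h⟩)
    · rcases Finset.mem_insert.mp ht with rfl | h
      · simp at hxt
      · exact Finset.mem_of_mem_erase h
    · exact (Finset.mem_insert.mp hB).resolve_left h

/-- The block containing `x` is unique, and `B` is that block without `x`. -/
theorem eq_of_adjoinPart_eq {x : α} {s : Finset α} (hx : x ∉ s) (Q Q' : Finpartition s)
    {B B' : Finset α} (hB : B ∈ insert ∅ Q.parts) (hB' : B' ∈ insert ∅ Q'.parts)
    (h : adjoinPart x Q.parts B = adjoinPart x Q'.parts B') : Q = Q' ∧ B = B' := by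
  have hxB : ∀ (Q : Finpartition s) (B : Finset α), B ∈ insert ∅ Q.parts → x ∉ B := by
    intro Q B hB hxB
    rcases Finset.mem_insert.mp hB with rfl | h
    · simp at hxB
    · exact hx (Q.subset h hxB)
  have hBB : B = B' := by
    have h1 : insert x B ∈ adjoinPart x Q'.parts B' := h ▸ Finset.mem_insert_self _ _
    rcases Finset.mem_insert.mp h1 with h1 | h1
    · rw [← Finset.erase_insert (hxB Q B hB), h1, Finset.erase_insert (hxB Q' B' hB')]
    · exact absurd (Q'.subset (Finset.mem_of_mem_erase h1) (Finset.mem_insert_self _ _)) hx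
  refine ⟨?_, hBB⟩
  ext t
  rw [mem_parts_of_mem_adjoinPart hx Q hB, mem_parts_of_mem_adjoinPart hx Q' hB', h, hBB]

/-- Delete `x` from its block `C`. When `C` is {x}, what remains is empty, in agreement with the
convention that the empty `B` stands for a new block. -/
theorem exists_adjoinPartition_eq {x : α} {s : Finset α} (hx : x ∉ s)
    (P : Finpartition (insert x s)) :
    ∃ (Q : Finpartition s) (B : Finset α) (hB : B ∈ insert ∅ Q.parts),
      adjoinPartition hx Q B hB = P := by
  have hsub : s ⊆ insert x s := Finset.subset_insert _ _
  have hxs : x ∈ insert x s := Finset.mem_insert_self _ _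
  set C := P.part x with hC
  have hCP : C ∈ P.parts := P.part_mem.mpr hxs
  have hxC : x ∈ C := P.mem_part_self.mpr hxs
  have hne : ∀ t ∈ P.parts, x ∈ t → t = C := fun t ht hxt => P.eq_of_mem_parts ht hCP hxt hxC
  have hCs : C.erase x ⊆ s := by
    intro y hy
    have := P.subset hCP (Finset.mem_of_mem_erase hy)
    exact (Finset.mem_insert.mp this).resolve_left (Finset.ne_of_mem_erase hy)
  have hmem : ∀ t, t ∈ (insert (C.erase x) (P.parts.erase C)).erase ∅ ↔
      t ≠ ∅ ∧ (t = C.erase x ∨ t ≠ C ∧ t ∈ P.parts) := by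
    intro t; simp
  -- Erasing ∅ matters only when `C` is {x}.
  let Q : Finpartition s := Finpartition.ofExistsUnique
    ((insert (C.erase x) (P.parts.erase C)).erase ∅)
    (by
      intro t ht
      obtain ⟨-, rfl | ⟨h1, h2⟩⟩ := (hmem t).mp ht
      · exact hCs
      · intro y hy
        refine (Finset.mem_insert.mp (P.subset h2 hy)).resolve_left ?_
        rintro rfl
        exact h1 (hne t h2 hy))
    (by
      intro y hy
      have hyx : y ≠ x := by rintro rfl; exact hx hy
      obtain ⟨t, ⟨ht, hyt⟩, huniq⟩ := P.existsUnique_mem (hsub hy)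
      refine ⟨t.erase x, ⟨(hmem _).mpr ⟨?_, ?_⟩, by simp [hyx, hyt]⟩, ?_⟩
      · exact Finset.ne_empty_of_mem (Finset.mem_erase.mpr ⟨hyx, hyt⟩)
      · by_cases htC : t = C
        · exact .inl (by rw [htC])
        · have : x ∉ t := fun h => htC (hne t ht h)
          rw [Finset.erase_eq_of_notMem this]
          exact .inr ⟨htC, ht⟩
      · rintro u ⟨hu, hyu⟩
        obtain ⟨-, rfl | ⟨h1, h2⟩⟩ := (hmem u).mp hu
        · rw [huniq C ⟨hCP, Finset.mem_of_mem_erase hyu⟩]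
        · rw [← huniq u ⟨h2, hyu⟩, Finset.erase_eq_of_notMem fun h => h1 (hne u h2 h)])
    (by simp)
  have hQ : Q.parts = (insert (C.erase x) (P.parts.erase C)).erase ∅ := rfl
  refine ⟨Q, C.erase x, ?_, ?_⟩
  · by_cases h : C.erase x = ∅
    · simp [h]
    · exact Finset.mem_insert_of_mem ((hmem _).mpr ⟨h, .inl rfl⟩)
  · ext t
    rw [parts_adjoinPartition, adjoinPart, hQ, Finset.insert_erase hxC]
    simp only [Finset.mem_insert, Finset.mem_erase]
    constructor
    · rintro (rfl | ⟨h1, h2, h3 | h3⟩)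
      · exact hCP
      · exact absurd h3 h1
      · exact h3.2
    · intro ht
      by_cases h : t = C
      · exact .inl h
      · refine .inr ⟨?_, P.ne_empty ht, .inr ⟨h, ht⟩⟩
        rintro rfl
        obtain ⟨y, hy⟩ := P.nonempty_of_mem_parts ht
        exact h (P.eq_of_mem_parts ht hCP hy (Finset.mem_of_mem_erase hy))

/-- `F` depends on the bare set of parts, so the same function applies to partitions of different
ground sets. -/
theorem sum_finpartition_insert {M : Type*} [AddCommMonoid M] {x : α} {s : Finset α} (hx : x ∉ s)
    (F : Finset (Finset α) → M) :
    ∑ P : Finpartition (insert x s), F P.parts =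
      ∑ Q : Finpartition s, (F (insert {x} Q.parts) +
        ∑ B ∈ Q.parts, F (insert (insert x B) (Q.parts.erase B))) := by
  have h1 : ∀ Q : Finpartition s, F (insert {x} Q.parts) +
      ∑ B ∈ Q.parts, F (insert (insert x B) (Q.parts.erase B)) =
      ∑ B ∈ (insert ∅ Q.parts).attach, F (adjoinPart x Q.parts B.1) := by
    intro Q
    rw [Finset.sum_attach (insert ∅ Q.parts) (fun B => F (adjoinPart x Q.parts B)),
      Finset.sum_insert Q.empty_notMem_parts, adjoinPart,
      Finset.erase_eq_of_notMem Q.empty_notMem_parts]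
    rfl
  simp only [h1]
  rw [Finset.sum_sigma']
  symm
  refine Finset.sum_bij (fun q _ => adjoinPartition hx q.1 q.2.1 q.2.2) ?_ ?_ ?_ ?_
  · simp
  · rintro ⟨Q, B, hB⟩ - ⟨Q', B', hB'⟩ - h
    obtain ⟨rfl, rfl⟩ := eq_of_adjoinPart_eq hx Q Q' hB hB' (congrArg Finpartition.parts h)
    rfl
  · intro P _
    obtain ⟨Q, B, hB, h⟩ := exists_adjoinPartition_eq hx P
    exact ⟨⟨Q, B, hB⟩, Finset.mem_sigma.mpr ⟨Finset.mem_univ _, Finset.mem_attach _ _⟩, h⟩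
  · intros; rfl

end Partitions

/-! ### Symmetric sums -/

section Symmetric

variable {R : Type} [CommRing R]

/-- The value of `f` at the index of depth one with entry `m`. -/
def letterVal (f : Index → R) (m : ℕ) : R := if h : 0 < m then f [⟨m, h⟩] else 0

theorem letterVal_coe (f : Index → R) (a : ℕ+) : letterVal f a = f [a] := by
  rw [letterVal, dif_pos a.pos]; rfl

/-- The contribution of a block `B` to the sum over set partitions. -/
def blockWeight {α : Type*} (ε : R) (f : Index → R) (k : α → ℕ+) (B : Finset α) : R :=
  ε ^ (B.card - 1) * (Nat.factorial (B.card - 1) : R) * letterVal f (∑ j ∈ B, (k j : ℕ))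

/-- The weighted sum over all set partitions of `s`. -/
def partitionSum {α : Type*} [DecidableEq α] (ε : R) (f : Index → R) (s : Finset α)
    (k : α → ℕ+) : R :=
  ∑ P : Finpartition s, ∏ B ∈ P.parts, blockWeight ε f k B

theorem blockWeight_singleton {α : Type*} (ε : R) (f : Index → R) (k : α → ℕ+) (x : α) :
    blockWeight ε f k {x} = f [k x] := by
  simp [blockWeight, letterVal_coe]

section

variable {α : Type*} [DecidableEq α]

theorem blockWeight_update_of_notMem (ε : R) (f : Index → R) (k : α → ℕ+) {B : Finset α} {j : α}
    (hj : j ∉ B) (a : ℕ+) : blockWeight ε f (Function.update k j a) B = blockWeight ε f k B := by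
  rw [blockWeight, blockWeight]
  congr 2
  refine Finset.sum_congr rfl fun i hi => ?_
  rw [Function.update_of_ne]
  rintro rfl
  exact hj hi

/-- Adding k_x to any entry of `B` yields the same block total, so the #B summands are equal and
turn (#B-1)! into (#B)!; the enlarged block carries one more factor ε. -/
theorem blockWeight_insert (ε : R) (f : Index → R) (k : α → ℕ+) {B : Finset α} {x : α}
    (hx : x ∉ B) (hB : B.Nonempty) :
    blockWeight ε f k (insert x B) =
      ε * ∑ j ∈ B, blockWeight ε f (Function.update k j (k x + k j)) B := by
  have h1 : ∀ j ∈ B, blockWeight ε f (Function.update k j (k x + k j)) B =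
      ε ^ (B.card - 1) * (Nat.factorial (B.card - 1) : R) *
        letterVal f (∑ i ∈ insert x B, (k i : ℕ)) := by
    intro j hj
    rw [blockWeight]
    congr 2
    rw [Finset.sum_insert hx, ← Finset.add_sum_erase _ _ hj, ← Finset.add_sum_erase B _ hj,
      Function.update_self, PNat.add_coe, add_assoc]
    congr 2
    refine Finset.sum_congr rfl fun i hi => ?_
    rw [Function.update_of_ne (Finset.ne_of_mem_erase hi)]
  rw [Finset.sum_congr rfl h1, Finset.sum_const, blockWeight, Finset.card_insert_of_notMem hx,
    nsmul_eq_mul, Nat.add_sub_cancel]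
  obtain ⟨c, hc⟩ : ∃ c, B.card = c + 1 := ⟨B.card - 1, by have := hB.card_pos; omega⟩
  rw [hc, Nat.add_sub_cancel, Nat.factorial_succ, pow_succ]
  push_cast
  ring

/-- The first term comes from the partitions with block {x}. In the others, `x` has joined a block
`C`, and `blockWeight_insert` spreads k_x over the entries of `C`. -/
theorem partitionSum_insert (ε : R) (f : Index → R) {s : Finset α} {x : α} (hx : x ∉ s)
    (k : α → ℕ+) :
    partitionSum ε f (insert x s) k = f [k x] * partitionSum ε f s k +
      ε * ∑ j ∈ s, partitionSum ε f s (Function.update k j (k x + k j)) := by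
  simp only [partitionSum]
  rw [sum_finpartition_insert hx fun 𝒬 => ∏ B ∈ 𝒬, blockWeight ε f k B, Finset.sum_add_distrib,
    Finset.mul_sum, Finset.sum_comm (s := s), Finset.mul_sum]
  congr 1
  · refine Finset.sum_congr rfl fun Q _ => ?_
    rw [Finset.prod_insert, blockWeight_singleton]
    exact fun h => hx (Q.subset h (Finset.mem_singleton_self x))
  · refine Finset.sum_congr rfl fun Q _ => ?_
    -- The blocks of `Q` cover `s` disjointly, so summing over j in `s` is summing over blocks and
    -- their elements.
    have h1 : ∑ j ∈ s, ∏ B ∈ Q.parts, blockWeight ε f (Function.update k j (k x + k j)) B =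
        ∑ C ∈ Q.parts, ∑ j ∈ C,
          ∏ B ∈ Q.parts, blockWeight ε f (Function.update k j (k x + k j)) B := by
      have h2 := Finset.sum_biUnion (t := id) Q.disjoint
        (f := fun j => ∏ B ∈ Q.parts, blockWeight ε f (Function.update k j (k x + k j)) B)
      rwa [Q.biUnion_parts] at h2
    rw [h1, Finset.mul_sum]
    refine Finset.sum_congr rfl fun C hC => ?_
    have hxC : x ∉ C := fun h => hx (Q.subset hC h)
    rw [Finset.prod_insert, blockWeight_insert ε f k hxC (Q.nonempty_of_mem_parts hC), mul_assoc,
      Finset.sum_mul]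
    · congr 1
      refine Finset.sum_congr rfl fun j hj => ?_
      rw [← Finset.mul_prod_erase _ _ hC]
      congr 1
      refine Finset.prod_congr rfl fun B hB => ?_
      rw [blockWeight_update_of_notMem]
      exact fun h => Finset.ne_of_mem_erase hB
        (Q.eq_of_mem_parts (Finset.mem_of_mem_erase hB) hC h hj)
    · exact fun h => hx (Q.subset (Finset.mem_of_mem_erase h) (Finset.mem_insert_self x C))

end

/-! ### Permutation sums and their recursion -/

/-- The sum of `g` over all permutations of an index. -/
def permSum (g : Index → R) {r : ℕ} (k : Fin r → ℕ+) : R :=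
  ∑ σ : Equiv.Perm (Fin r), g (List.ofFn fun i => k (σ i))

theorem insertSum_ofFn (ε : R) (a : ℕ+) (g : Index → R) {r : ℕ} (k : Fin r → ℕ+) :
    insertSum ε a g (List.ofFn k) =
      ∑ i : Fin (r + 1), g (List.ofFn (i.insertNth a k : Fin (r + 1) → ℕ+)) +
        ε * ∑ i : Fin r, g (List.ofFn (Function.update k i (a + k i))) := by
  induction r generalizing g with
  | zero => simp [insertSum_nil]
  | succ r ih =>
    have h0 := Fin.sum_univ_succ (n := r) fun i =>
      g (List.ofFn (Function.update k i (a + k i)))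
    rw [h0, List.ofFn_succ, insertSum_cons, ih, Fin.sum_univ_succ (n := r + 1)]
    have h1 : ∀ i : Fin (r + 1), List.ofFn (i.succ.insertNth a k : Fin (r + 2) → ℕ+) =
        k 0 :: List.ofFn (i.insertNth a (fun j => k j.succ) : Fin (r + 1) → ℕ+) := by
      intro i
      have e := Fin.insertNth_succ_cons i a (k 0) (Fin.tail k)
      rw [Fin.cons_self_tail] at e
      rw [e, List.ofFn_succ]
      rfl
    have h2 : ∀ i : Fin r, List.ofFn (Function.update k i.succ (a + k i.succ)) =
        k 0 :: List.ofFn (Function.update (fun j : Fin r => k j.succ) i (a + k i.succ)) := by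
      intro i
      rw [List.ofFn_succ, Function.update_of_ne (Fin.succ_ne_zero i).symm]
      congr 2
      ext j
      simp [Function.update_apply]
    have h3 : List.ofFn (Function.update k 0 (a + k 0)) =
        (a + k 0) :: List.ofFn fun j : Fin r => k j.succ := by
      rw [List.ofFn_succ]
      simp
    have h4 : List.ofFn ((0 : Fin (r + 2)).insertNth a k : Fin (r + 2) → ℕ+) =
        a :: k 0 :: List.ofFn fun j : Fin r => k j.succ := by
      rw [List.ofFn_succ, List.ofFn_succ]
      simp
    simp only [h1, h2, h3, h4]
    ring

/-- A permutation of `Fin (r + 1)` from the preimage `i` of `0` and a permutation of `Fin r`. -/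
def insertPerm {r : ℕ} (q : Fin (r + 1) × Equiv.Perm (Fin r)) : Equiv.Perm (Fin (r + 1)) :=
  ((finSuccEquiv' q.1).trans (Equiv.optionCongr q.2)).trans (finSuccEquiv' 0).symm

theorem insertPerm_apply_self {r : ℕ} (i : Fin (r + 1)) (σ : Equiv.Perm (Fin r)) :
    insertPerm (i, σ) i = 0 := by
  simp [insertPerm]

theorem insertPerm_apply_succAbove {r : ℕ} (i : Fin (r + 1)) (σ : Equiv.Perm (Fin r))
    (j : Fin r) : insertPerm (i, σ) (i.succAbove j) = (σ j).succ := by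
  simp [insertPerm]

theorem insertPerm_bijective {r : ℕ} :
    Function.Bijective (insertPerm : Fin (r + 1) × Equiv.Perm (Fin r) → _) := by
  rw [Fintype.bijective_iff_injective_and_card]
  constructor
  · rintro ⟨i, σ⟩ ⟨i', σ'⟩ h
    obtain rfl : i = i' := by
      apply (insertPerm (i', σ')).injective
      rw [insertPerm_apply_self, ← h, insertPerm_apply_self]
    congr 1
    ext j
    have := congrArg (fun e : Equiv.Perm (Fin (r + 1)) => e (i.succAbove j)) h
    simp only [insertPerm_apply_succAbove] at this
    rw [Fin.succ_injective _ this]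
  · simp [Fintype.card_perm, Nat.factorial_succ]

/-- The product rule, applied to each permutation of the tail and solved for the insertion terms.
Inserting `k 0` at every position of every permuted tail lists each permutation of the whole index
once. -/
theorem permSum_succ (ε : R) (f g : Index → R)
    (h : ∀ a v, f [a] * g v = insertSum (-ε) a g v) {r : ℕ} (k : Fin (r + 1) → ℕ+) :
    permSum g k = f [k 0] * permSum g (fun i => k i.succ) +
      ε * ∑ j, permSum g (Function.update (fun i : Fin r => k i.succ) j (k 0 + k j.succ)) := by
  have h1 : permSum g k = ∑ σ : Equiv.Perm (Fin r), ∑ i : Fin (r + 1),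
      g (List.ofFn (i.insertNth (k 0) (fun j => k (σ j).succ) : Fin (r + 1) → ℕ+)) := by
    rw [permSum, ← insertPerm_bijective.sum_comp, Fintype.sum_prod_type, Finset.sum_comm]
    refine Finset.sum_congr rfl fun σ _ => Finset.sum_congr rfl fun i _ => ?_
    congr 2
    symm
    rw [Fin.insertNth_eq_iff]
    refine ⟨by rw [insertPerm_apply_self], ?_⟩
    ext j
    simp [Fin.removeNth, insertPerm_apply_succAbove]
  have h2 : ∑ j, permSum g (Function.update (fun i : Fin r => k i.succ) j (k 0 + k j.succ)) =
      ∑ σ : Equiv.Perm (Fin r), ∑ i : Fin r,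
        g (List.ofFn (Function.update (fun i => k (σ i).succ) i (k 0 + k (σ i).succ))) := by
    simp only [permSum]
    rw [Finset.sum_comm]
    refine Finset.sum_congr rfl fun σ _ => ?_
    -- With j = σ i, updating entry j before permuting is updating position i afterwards.
    rw [← Equiv.sum_comp σ]
    refine Finset.sum_congr rfl fun i _ => ?_
    congr 2
    ext j
    simp [Function.update_apply]
  rw [h1, h2, permSum, Finset.mul_sum, Finset.mul_sum, ← Finset.sum_add_distrib]
  refine Finset.sum_congr rfl fun σ _ => ?_
  rw [h, insertSum_ofFn]
  ring

/-- The symmetric sum formula for a function with a product rule for depth one factors. -/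
theorem permSum_eq_partitionSum {α : Type*} [DecidableEq α] (ε : R) (f g : Index → R)
    (h0 : g [] = 1) (h : ∀ a v, f [a] * g v = insertSum (-ε) a g v) {r : ℕ} (e : Fin r ↪ α)
    (k : α → ℕ+) :
    permSum g (fun i => k (e i)) = partitionSum ε f (Finset.univ.map e) k := by
  -- The set `α` stays fixed while the embedding shrinks, so changing an entry of the tail is an
  -- update of `k` itself.
  induction r generalizing k with
  | zero =>
    have : (Finset.univ : Finset (Fin 0)).map e = ⊥ := by simp
    rw [this, partitionSum, Fintype.sum_unique, Finpartition.parts_eq_empty_iff.mpr rfl]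
    simp [permSum, h0]
  | succ r ih =>
    set e' : Fin r ↪ α := (Fin.succEmb r).trans e with he'
    have h1 : (Finset.univ : Finset (Fin (r + 1))).map e =
        insert (e 0) (Finset.univ.map e') := by
      rw [Fin.univ_succ, Finset.map_cons, Finset.cons_eq_insert, Finset.map_map]
      rfl
    have h2 : e 0 ∉ Finset.univ.map e' := by
      simp [he', Fin.succ_ne_zero]
    rw [h1, partitionSum_insert _ _ h2, permSum_succ ε f g h, Finset.sum_map, ← ih e' k]
    congr 2
    refine Finset.sum_congr rfl fun j _ => ?_
    rw [← ih e']
    congr 1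
    ext i
    simp [Function.update_apply, he']

theorem letterVal_eq_blockSum (f : Index → R) {r : ℕ} (k : Fin r → ℕ+) (B : Finset (Fin r))
    (hB : B.Nonempty) : letterVal f (∑ j ∈ B, (k j : ℕ)) = f [blockSum k B hB] := by
  rw [← letterVal_coe f (blockSum k B hB)]; rfl

/-- The exponents of ε add up by Σ (#B - 1) = r - l; no subtraction truncates, since blocks are
nonempty. -/
theorem prod_blockWeight (ε : R) (f : Index → R) {r : ℕ} (k : Fin r → ℕ+)
    (P : Finpartition (Finset.univ : Finset (Fin r))) :
    ∏ B ∈ P.parts, blockWeight ε f k B =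
      ε ^ (r - P.parts.card) * (partCoeff P : R) * blockProd f k P := by
  simp only [blockWeight, Finset.prod_mul_distrib]
  congr 1
  · congr 1
    · rw [Finset.prod_pow_eq_pow_sum]
      congr 1
      have h1 := P.sum_card_parts
      rw [Finset.card_univ, Fintype.card_fin] at h1
      have h2 : ∑ B ∈ P.parts, B.card = ∑ B ∈ P.parts, (B.card - 1) + P.parts.card := by
        rw [Finset.card_eq_sum_ones, ← Finset.sum_add_distrib]
        refine Finset.sum_congr rfl fun B hB => ?_
        have := (P.nonempty_of_mem_parts hB).card_pos
        omega
      omega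
    · simp [partCoeff]
  · rw [blockProd, ← Finset.prod_attach]
    exact Finset.prod_congr rfl fun B _ => letterVal_eq_blockSum f k B.1 _

theorem IsStuffle.symmetric_sum {f : Index → R} (hf : IsStuffle f) (h0 : f [] = 1) {r : ℕ}
    (k : Fin r → ℕ+) :
    ∑ σ : Equiv.Perm (Fin r), f (List.ofFn fun i => k (σ i)) =
      ∑ P : Finpartition (Finset.univ : Finset (Fin r)),
        (-1) ^ (r - P.parts.card) * (partCoeff P : R) * blockProd f k P := by
  have := permSum_eq_partitionSum (-1) f f h0 (by rw [neg_neg]; exact hf)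
    (Function.Embedding.refl (Fin r)) k
  rw [Finset.map_refl, partitionSum, permSum] at this
  simpa only [prod_blockWeight, Function.Embedding.refl_apply] using this

theorem IsStuffle.symmetric_starSum {f : Index → R} (hf : IsStuffle f) (h0 : f [] = 1) {r : ℕ}
    (k : Fin r → ℕ+) :
    ∑ σ : Equiv.Perm (Fin r), starSum f (List.ofFn fun i => k (σ i)) =
      ∑ P : Finpartition (Finset.univ : Finset (Fin r)),
        (partCoeff P : R) * blockProd f k P := by
  have := permSum_eq_partitionSum 1 f (starSum f) (by rw [starSum_nil, h0]) hf.mul_starSum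
    (Function.Embedding.refl (Fin r)) k
  rw [Finset.map_refl, partitionSum, permSum] at this
  simpa only [prod_blockWeight, Function.Embedding.refl_apply, one_pow, one_mul] using this

end Symmetric

/-! ### Sums over monotone tuples -/

section Tuples

variable {R : Type*} [CommRing R]

theorem strictMono_cons_iff {n : ℕ} (x : ℕ) (f : Fin n → ℕ) :
    StrictMono (Fin.cons x f : Fin (n + 1) → ℕ) ↔ (∀ i, x < f i) ∧ StrictMono f := by
  constructor
  · intro h
    exact ⟨fun i => by simpa using h (Fin.succ_pos i), fun i j hij => by
      simpa using h (Fin.succ_lt_succ_iff.mpr hij)⟩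
  · rintro ⟨h1, h2⟩ i j hij
    induction j using Fin.cases with
    | zero => simp at hij
    | succ j =>
      induction i using Fin.cases with
      | zero => simpa using h1 j
      | succ i => simpa using h2 (Fin.succ_lt_succ_iff.mp hij)

theorem monotone_cons_iff {n : ℕ} (x : ℕ) (f : Fin n → ℕ) :
    Monotone (Fin.cons x f : Fin (n + 1) → ℕ) ↔ (∀ i, x ≤ f i) ∧ Monotone f := by
  constructor
  · intro h
    exact ⟨fun i => by simpa using h (Fin.zero_le i.succ), fun i j hij => by
      simpa using h (Fin.succ_le_succ_iff.mpr hij)⟩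
  · rintro ⟨h1, h2⟩ i j hij
    induction j using Fin.cases with
    | zero => rw [Fin.le_zero_iff.mp hij]
    | succ j =>
      induction i using Fin.cases with
      | zero => simpa using h1 j
      | succ i => simpa using h2 (Fin.succ_le_succ_iff.mp hij)

open Classical in
/-- Strictly increasing tuples with entries in `[M, M + L)`. -/
noncomputable def strictTuples (n M L : ℕ) : Finset (Fin n → ℕ) :=
  (Fintype.piFinset fun _ => Finset.Ico M (M + L)).filter (fun m => StrictMono m)

open Classical in
/-- Weakly increasing tuples with entries in `[M, M + L)`. -/
noncomputable def weakTuples (n M L : ℕ) : Finset (Fin n → ℕ) :=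
  (Fintype.piFinset fun _ => Finset.Ico M (M + L)).filter (fun m => Monotone m)

theorem mem_strictTuples {n M L : ℕ} {m : Fin n → ℕ} :
    m ∈ strictTuples n M L ↔ (∀ i, M ≤ m i ∧ m i < M + L) ∧ StrictMono m := by
  simp [strictTuples, Fintype.mem_piFinset]

theorem mem_weakTuples {n M L : ℕ} {m : Fin n → ℕ} :
    m ∈ weakTuples n M L ↔ (∀ i, M ≤ m i ∧ m i < M + L) ∧ Monotone m := by
  simp [weakTuples, Fintype.mem_piFinset]

/-- Either `M` is not attained or it is the first entry and all others exceed it: the recursion of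
`qsum`. -/
theorem strictTuples_succ (n M L : ℕ) :
    strictTuples (n + 1) M (L + 1) = strictTuples (n + 1) (M + 1) L ∪
      (strictTuples n (M + 1) L).image (fun f => (Fin.cons M f : Fin (n + 1) → ℕ)) := by
  ext m
  induction m using Fin.consCases with
  | cons x f =>
    simp only [Finset.mem_union, Finset.mem_image, mem_strictTuples, strictMono_cons_iff,
      Fin.cons_inj, Fin.forall_fin_succ, Fin.cons_zero, Fin.cons_succ]
    constructor
    · rintro ⟨⟨⟨h1, h2⟩, h3⟩, h4, h5⟩
      rcases h1.eq_or_lt with rfl | h1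
      · exact .inr ⟨f, ⟨fun i => ⟨h4 i, by have := h3 i; omega⟩, h5⟩, rfl, rfl⟩
      · exact .inl ⟨⟨⟨h1, by omega⟩, fun i => ⟨by have := h4 i; omega, by have := h3 i; omega⟩⟩,
          h4, h5⟩
    · rintro (⟨⟨⟨h1, h2⟩, h3⟩, h4, h5⟩ | ⟨f, ⟨h1, h2⟩, rfl, rfl⟩)
      · exact ⟨⟨⟨by omega, by omega⟩, fun i => ⟨by have := h3 i; omega, by have := h3 i; omega⟩⟩,
          h4, h5⟩
      · exact ⟨⟨⟨le_rfl, by omega⟩, fun i => ⟨by have := h1 i; omega, by have := h1 i; omega⟩⟩,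
          fun i => (h1 i).1, h2⟩

theorem weakTuples_succ (n M L : ℕ) :
    weakTuples (n + 1) M (L + 1) = weakTuples (n + 1) (M + 1) L ∪
      (weakTuples n M (L + 1)).image (fun f => (Fin.cons M f : Fin (n + 1) → ℕ)) := by
  ext m
  induction m using Fin.consCases with
  | cons x f =>
    simp only [Finset.mem_union, Finset.mem_image, mem_weakTuples, monotone_cons_iff,
      Fin.cons_inj, Fin.forall_fin_succ, Fin.cons_zero, Fin.cons_succ]
    constructor
    · rintro ⟨⟨⟨h1, h2⟩, h3⟩, h4, h5⟩
      rcases h1.eq_or_lt with rfl | h1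
      · exact .inr ⟨f, ⟨h3, h5⟩, rfl, rfl⟩
      · exact .inl ⟨⟨⟨h1, by omega⟩, fun i => ⟨by have := h4 i; omega, by have := h3 i; omega⟩⟩,
          h4, h5⟩
    · rintro (⟨⟨⟨h1, h2⟩, h3⟩, h4, h5⟩ | ⟨f, ⟨h1, h2⟩, rfl, rfl⟩)
      · exact ⟨⟨⟨by omega, by omega⟩, fun i => ⟨by have := h3 i; omega, by have := h3 i; omega⟩⟩,
          h4, h5⟩
      · exact ⟨⟨⟨le_rfl, by omega⟩, h1⟩, fun i => (h1 i).1, h2⟩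

/-- The monomial in the values of `g` at a tuple with exponents `k`. -/
def tupleTerm (g : ℕ → R) (k : Index) (m : Fin k.length → ℕ) : R :=
  ∏ i, g (m i) ^ (k.get i : ℕ)

theorem tupleTerm_cons (g : ℕ → R) (a : ℕ+) (w : Index) (x : ℕ) (f : Fin w.length → ℕ) :
    tupleTerm g (a :: w) (Fin.cons x f : Fin (w.length + 1) → ℕ) =
      g x ^ (a : ℕ) * tupleTerm g w f := by
  rw [tupleTerm, tupleTerm, show (∏ i : Fin (a :: w).length, _) =
    ∏ i : Fin (w.length + 1), g ((Fin.cons x f : Fin (w.length + 1) → ℕ) i) ^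
      (((a :: w).get i : ℕ+) : ℕ) from rfl, Fin.prod_univ_succ]
  simp

theorem sum_image_cons (g : ℕ → R) (a : ℕ+) (w : Index) (x : ℕ)
    (s : Finset (Fin w.length → ℕ)) :
    ∑ m ∈ s.image (fun f => (Fin.cons x f : Fin (w.length + 1) → ℕ)),
      tupleTerm g (a :: w) m = g x ^ (a : ℕ) * ∑ m ∈ s, tupleTerm g w m := by
  rw [Finset.sum_image fun f _ f' _ h => Fin.cons_right_injective _ h, Finset.mul_sum]
  exact Finset.sum_congr rfl fun f _ => tupleTerm_cons g a w x f

theorem sum_strictTuples (g : ℕ → R) (M L : ℕ) (k : Index) :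
    ∑ m ∈ strictTuples k.length M L, tupleTerm g k m = qsum ((List.range' M L).map g) k := by
  induction L generalizing M k with
  | zero =>
    cases k with
    | nil => simp [strictTuples, tupleTerm, Finset.filter_true_of_mem, StrictMono]
    | cons a w =>
      have : strictTuples (a :: w).length M 0 = ∅ := by
        refine Finset.eq_empty_of_forall_notMem fun m hm => ?_
        have := (mem_strictTuples.mp hm).1 ⟨0, by simp⟩
        omega
      rw [this]; simp
  | succ L ih =>
    cases k with
    | nil => simp [strictTuples, tupleTerm, Finset.filter_true_of_mem, StrictMono]
    | cons a w =>
      rw [List.range'_succ, List.map_cons, qsum_cons_cons, ← ih, ← ih, ← sum_image_cons]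
      refine Eq.trans ?_ (Finset.sum_union (f := tupleTerm g (a :: w)) ?_)
      · exact Finset.sum_congr (strictTuples_succ w.length M L) fun _ _ => rfl
      · rw [Finset.disjoint_left]
        rintro m hm hm'
        obtain ⟨f, -, rfl⟩ := Finset.mem_image.mp hm'
        have := (mem_strictTuples.mp hm).1 ⟨0, by simp⟩
        exact absurd this.1 (by show ¬ M + 1 ≤ M; omega)

theorem sum_weakTuples (g : ℕ → R) (M L : ℕ) (k : Index) :
    ∑ m ∈ weakTuples k.length M L, tupleTerm g k m = qsumStar ((List.range' M L).map g) k := by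
  induction L generalizing M k with
  | zero =>
    cases k with
    | nil => simp [weakTuples, tupleTerm, Finset.filter_true_of_mem, Monotone]
    | cons a w =>
      have : weakTuples (a :: w).length M 0 = ∅ := by
        refine Finset.eq_empty_of_forall_notMem fun m hm => ?_
        have := (mem_weakTuples.mp hm).1 ⟨0, by simp⟩
        omega
      rw [this]; simp
  | succ L ih =>
    -- In the weak case `M` may occur again, so the interval does not shrink and a second induction,
    -- on the index, is needed.
    induction k with
    | nil => simp [weakTuples, tupleTerm, Finset.filter_true_of_mem, Monotone]
    | cons a w ihw =>
      rw [List.range'_succ, List.map_cons, qsumStar_cons_cons, ← ih, ← List.map_cons,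
        ← List.range'_succ, ← ihw, ← sum_image_cons]
      refine Eq.trans ?_ (Finset.sum_union (f := tupleTerm g (a :: w)) ?_)
      · exact Finset.sum_congr (weakTuples_succ w.length M L) fun _ _ => rfl
      · rw [Finset.disjoint_left]
        rintro m hm hm'
        obtain ⟨f, -, rfl⟩ := Finset.mem_image.mp hm'
        have := (mem_weakTuples.mp hm).1 ⟨0, by simp⟩
        exact absurd this.1 (by show ¬ M + 1 ≤ M; omega)

end Tuples

/-! ### The values in `𝒜ₙ` -/

/-- The list `1⁻¹, …, (p - 1)⁻¹` in `ℤ/N`. -/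
def invList (N p : ℕ) : List (ZMod N) := (List.range' 1 (p - 1)).map fun m : ℕ => (m : ZMod N)⁻¹

/-- The inverse in `ZMod` is a true inverse only on units. Here 0 < m < p makes m prime to p^n, so
inversion commutes with powers. -/
theorem modTerm_eq_tupleTerm (n : ℕ) (p : Nat.Primes) (k : Index) (m : Fin k.length → ℕ)
    (hm : ∀ i, 1 ≤ m i ∧ m i < 1 + (p - 1)) :
    modTerm ((p : ℕ) ^ n) k m = tupleTerm (fun m : ℕ => (m : ZMod ((p : ℕ) ^ n))⁻¹) k m := by
  refine Finset.prod_congr rfl fun i _ => ?_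
  have hcop : (m i).Coprime ((p : ℕ) ^ n) := by
    refine Nat.Coprime.pow_right _ (Nat.Coprime.symm ?_)
    refine (Nat.Prime.coprime_iff_not_dvd p.2).mpr fun h => ?_
    have := Nat.le_of_dvd (hm i).1 h
    have := hm i
    omega
  have h1 := ZMod.coe_mul_inv_eq_one (m i) hcop
  have h2 : ((m i ^ (k.get i : ℕ) : ℕ) : ZMod ((p : ℕ) ^ n)) *
      ((m i ^ (k.get i : ℕ) : ℕ) : ZMod ((p : ℕ) ^ n))⁻¹ = 1 :=
    ZMod.coe_mul_inv_eq_one _ (hcop.pow_left _)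
  push_cast at h2
  have h3 := congrArg (· ^ (k.get i : ℕ)) h1
  simp only [mul_pow, one_pow] at h3
  exact (IsUnit.of_mul_eq_one _ h2).mul_left_cancel (h2.trans h3.symm)

theorem zetaA_eq (n : ℕ) (k : Index) :
    zetaA n k = Ideal.Quotient.mk _ fun p : Nat.Primes => qsum (invList ((p : ℕ) ^ n) p) k := by
  rw [zetaA]
  refine congrArg _ (funext fun p : Nat.Primes => ?_)
  have hp := p.2.two_le
  rw [invList, ← sum_strictTuples]
  refine Finset.sum_congr ?_ fun m hm => modTerm_eq_tupleTerm n p k m (mem_strictTuples.mp hm).1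
  ext m
  simp only [Finset.mem_filter, Fintype.mem_piFinset, Finset.mem_Ioo, mem_strictTuples]
  refine and_congr_left fun _ => forall_congr' fun i => ?_
  omega

theorem zetaStarA_eq (n : ℕ) (k : Index) :
    zetaStarA n k = Ideal.Quotient.mk _ fun p : Nat.Primes => qsumStar (invList ((p : ℕ) ^ n) p) k := by
  rw [zetaStarA]
  refine congrArg _ (funext fun p : Nat.Primes => ?_)
  have hp := p.2.two_le
  rw [invList, ← sum_weakTuples]
  refine Finset.sum_congr ?_ fun m hm => modTerm_eq_tupleTerm n p k m (mem_weakTuples.mp hm).1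
  ext m
  simp only [Finset.mem_filter, Fintype.mem_piFinset, Finset.mem_Icc, mem_weakTuples]
  refine and_congr_left fun _ => forall_congr' fun i => ?_
  omega

theorem isStuffle_pi {ι : Type*} {A : ι → Type*} [∀ i, CommRing (A i)]
    (f : ∀ i, Index → A i) (hf : ∀ i, IsStuffle (f i)) : IsStuffle fun k i => f i k := by
  intro a k
  ext i
  have := map_insertSum (Pi.evalRingHom A i) 1 a (fun k i => f i k) k
  rw [map_one] at this
  exact (hf i a k).trans this.symm

theorem isStuffle_zetaA (n : ℕ) : IsStuffle (zetaA n) := by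
  have := (isStuffle_pi (fun p : Nat.Primes => qsum (invList ((p : ℕ) ^ n) p))
    fun p => isStuffle_qsum _).map (Ideal.Quotient.mk (finIdeal n))
  rwa [show zetaA n = _ from funext (zetaA_eq n)]

theorem zetaA_nil (n : ℕ) : zetaA n [] = 1 := by
  rw [zetaA_eq]
  simp only [qsum_nil_right]
  exact map_one _

theorem zetaStarA_eq_starSum (n : ℕ) : zetaStarA n = starSum (zetaA n) := by
  ext k
  rw [zetaStarA_eq, show zetaA n = _ from funext (zetaA_eq n), ← map_starSum]
  refine congrArg _ (funext fun p : Nat.Primes => ?_)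
  rw [← starSum_qsum]
  exact (map_starSum (Pi.evalRingHom (fun p : Nat.Primes => ZMod ((p : ℕ) ^ n)) p)
    (fun k (p : Nat.Primes) => qsum (invList ((p : ℕ) ^ n) p) k) k).symm

/-! ### The harmonic algebra -/

section Harmonic

@[simp] theorem consL_word (a : ℕ+) (w : Index) : consL a (word w) = word (a :: w) := by
  simp [consL, word]

@[simp] theorem harm_word (v w : Index) : harm (word v) (word w) = harmWord v w := by
  simp [harm, word]

theorem harmWord_nil_left (w : Index) : harmWord [] w = word w := by
  rw [harmWord]

theorem harmWord_nil_right (v : Index) : harmWord v [] = word v := by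
  cases v <;> rw [harmWord]

theorem harmWord_cons_cons (a b : ℕ+) (v w : Index) :
    harmWord (a :: v) (b :: w) = consL a (harmWord v (b :: w)) + consL b (harmWord (a :: v) w) +
      consL (a + b) (harmWord v w) := by
  rw [harmWord]

theorem H1.induction {p : H1 → Prop} (hw : ∀ k, p (word k)) (hadd : ∀ x y, p x → p y → p (x + y))
    (hsmul : ∀ (c : ℚ) x, p x → p (c • x)) (x : H1) : p x := by
  induction x using Finsupp.induction_linear with
  | zero => simpa using hsmul 0 _ (hw [])
  | add f g hf hg => exact hadd f g hf hg
  | single k c =>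
    have := hsmul c _ (hw k)
    rwa [word, Finsupp.smul_single, smul_eq_mul, mul_one] at this

theorem harm_word_nil_left (x : H1) : harm (word []) x = x := by
  induction x using H1.induction with
  | hw k => rw [harm_word, harmWord_nil_left]
  | hadd x y hx hy => rw [map_add, hx, hy]
  | hsmul c x hx => rw [map_smul, hx]

theorem harm_word_nil_right (x : H1) : harm x (word []) = x := by
  induction x using H1.induction with
  | hw k => rw [harm_word, harmWord_nil_right]
  | hadd x y hx hy => rw [map_add, LinearMap.add_apply, hx, hy]
  | hsmul c x hx => rw [map_smul, LinearMap.smul_apply, hx]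

theorem harm_consL_consL (a b : ℕ+) (x y : H1) :
    harm (consL a x) (consL b y) = consL a (harm x (consL b y)) + consL b (harm (consL a x) y) +
      consL (a + b) (harm x y) := by
  induction x using H1.induction with
  | hw v =>
    induction y using H1.induction with
    | hw w => simp only [consL_word, harm_word, harmWord_cons_cons]
    | hadd x y hx hy => simp only [map_add, hx, hy]; abel
    | hsmul c x hx => simp only [map_smul, hx, smul_add]
  | hadd x y hx hy => simp only [map_add, LinearMap.add_apply, hx, hy]; abel
  | hsmul c x hx => simp only [map_smul, LinearMap.smul_apply, hx, smul_add]

theorem harmWord_comm (v w : Index) : harmWord v w = harmWord w v := by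
  suffices H : ∀ n, ∀ v w : Index, v.length + w.length ≤ n → harmWord v w = harmWord w v from
    H _ v w le_rfl
  intro n
  induction n with
  | zero =>
    intro v w h
    obtain rfl := List.length_eq_zero_iff.mp (by omega : v.length = 0)
    obtain rfl := List.length_eq_zero_iff.mp (by omega : w.length = 0)
    rfl
  | succ n ih =>
    intro v w h
    match v, w, h with
    | [], w, _ => rw [harmWord_nil_left, harmWord_nil_right]
    | a :: v, [], _ => rw [harmWord_nil_left, harmWord_nil_right]
    | a :: v, b :: w, h =>
      simp only [List.length_cons] at h
      rw [harmWord_cons_cons, harmWord_cons_cons, ih v (b :: w) (by simp; omega),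
        ih (a :: v) w (by simp; omega), ih v w (by omega), add_comm b a]
      abel

theorem harm_comm (x y : H1) : harm x y = harm y x := by
  induction x using H1.induction with
  | hw v =>
    induction y using H1.induction with
    | hw w => rw [harm_word, harm_word, harmWord_comm]
    | hadd x y hx hy => simp only [map_add, LinearMap.add_apply, hx, hy]
    | hsmul c x hx => simp only [map_smul, LinearMap.smul_apply, hx]
  | hadd x y hx hy => simp only [map_add, LinearMap.add_apply, hx, hy]
  | hsmul c x hx => simp only [map_smul, LinearMap.smul_apply, hx]

theorem harm_assoc_word (u v w : Index) :
    harm (harm (word u) (word v)) (word w) = harm (word u) (harm (word v) (word w)) := by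
  suffices H : ∀ n, ∀ u v w : Index, u.length + v.length + w.length ≤ n →
      harm (harm (word u) (word v)) (word w) = harm (word u) (harm (word v) (word w)) from
    H _ u v w le_rfl
  intro n
  induction n with
  | zero =>
    intro u v w h
    obtain rfl := List.length_eq_zero_iff.mp (by omega : u.length = 0)
    rw [harm_word_nil_left, harm_word_nil_left]
  | succ n ih =>
    intro u v w h
    match u, v, w, h with
    | [], v, w, _ => rw [harm_word_nil_left, harm_word_nil_left]
    | a :: u, [], w, _ => rw [harm_word_nil_left, harm_word_nil_right]
    | a :: u, b :: v, [], _ => rw [harm_word_nil_right, harm_word_nil_right]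
    | a :: u, b :: v, c :: w, h =>
      simp only [List.length_cons] at h
      have e1 := ih u (b :: v) (c :: w) (by simp; omega)
      have e2 := ih (a :: u) v (c :: w) (by simp; omega)
      have e3 := ih (a :: u) (b :: v) w (by simp; omega)
      have e4 := ih u v (c :: w) (by simp; omega)
      have e5 := ih u (b :: v) w (by simp; omega)
      have e6 := ih (a :: u) v w (by simp; omega)
      have e7 := ih u v w (by omega)
      have l1 : harm (word (a :: u)) (word (b :: v)) = consL a (harm (word u) (word (b :: v))) +
          consL b (harm (word (a :: u)) (word v)) + consL (a + b) (harm (word u) (word v)) := by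
        rw [← consL_word, ← consL_word, harm_consL_consL]
      have l2 : harm (word (b :: v)) (word (c :: w)) = consL b (harm (word v) (word (c :: w))) +
          consL c (harm (word (b :: v)) (word w)) + consL (b + c) (harm (word v) (word w)) := by
        rw [← consL_word, ← consL_word, harm_consL_consL]
      -- The terms starting with c, and those starting with a, appear in the goal with an inner
      -- product already expanded; the two corresponding induction hypotheses are therefore expanded
      -- too.
      have e3' := e3
      rw [l1] at e3'
      have e1' := e1
      rw [l2] at e1'
      rw [l1, l2]
      simp only [map_add, LinearMap.add_apply] at e1' e3' ⊢
      simp only [← consL_word c w, ← consL_word a u, harm_consL_consL]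
      simp only [consL_word, e1, e2, e4, e5, e6, e7] at e1' e3' ⊢
      have e1'' := congrArg (consL a) e1'
      have e3'' := congrArg (consL c) e3'
      simp only [map_add] at e1'' e3''
      rw [e1'', add_assoc a b c]
      rw [← sub_eq_zero] at e3'' ⊢
      rw [← e3'']
      abel

theorem harm_assoc (x y z : H1) : harm (harm x y) z = harm x (harm y z) := by
  induction x using H1.induction with
  | hw u =>
    induction y using H1.induction with
    | hw v =>
      induction z using H1.induction with
      | hw w => exact harm_assoc_word u v w
      | hadd x y hx hy => simp only [map_add, hx, hy]
      | hsmul c x hx => simp only [map_smul, hx]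
    | hadd x y hx hy => simp only [map_add, LinearMap.add_apply, hx, hy]
    | hsmul c x hx => simp only [map_smul, LinearMap.smul_apply, hx]
  | hadd x y hx hy => simp only [map_add, LinearMap.add_apply, hx, hy]
  | hsmul c x hx => simp only [map_smul, LinearMap.smul_apply, hx]

theorem harm_left_comm (x y z : H1) : harm x (harm y z) = harm y (harm x z) := by
  rw [← harm_assoc, harm_comm x y, harm_assoc]

/-! ### Existence of the decomposition defining the regularization -/

/-- The map `(aᵢ) ↦ ∑ aᵢ * e₁^{*i}`. -/
noncomputable def recombine : (ℕ →₀ H0) →ₗ[ℚ] H1 :=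
  Finsupp.lsum ℚ fun i => (harm.flip (e1Pow i)).comp H0.subtype

theorem recombine_apply (p : ℕ →₀ H0) :
    recombine p = p.sum fun i b => harm (b : H1) (e1Pow i) := by
  simp [recombine, Finsupp.lsum_apply, Function.comp_def]

theorem harm_one_mem_range {x : H1} (hx : x ∈ LinearMap.range recombine) :
    harm (word [1]) x ∈ LinearMap.range recombine := by
  obtain ⟨p, rfl⟩ := hx
  induction p using Finsupp.induction_linear with
  | zero => simp
  | add p q hp hq => rw [map_add, map_add]; exact add_mem hp hq
  | single i b =>
    refine ⟨Finsupp.single (i + 1) b, ?_⟩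
    rw [recombine_apply, recombine_apply, Finsupp.sum_single_index (by simp),
      Finsupp.sum_single_index (by simp), harm_left_comm]
    rfl

theorem word_mem_range {k : Index} (hk : Admissible k) : word k ∈ LinearMap.range recombine := by
  refine ⟨Finsupp.single 0 ⟨word k, Finsupp.single_mem_supported ℚ 1 hk⟩, ?_⟩
  rw [recombine_apply, Finsupp.sum_single_index (by simp)]
  exact harm_word_nil_right _

/-- The span of the words that consist of a nonempty admissible word and at most `s` further
letters `e₁`. -/
noncomputable def trailingSpan (s : ℕ) : Submodule ℚ H1 :=
  Submodule.span ℚ {x | ∃ (w : Index) (j : ℕ), w ≠ [] ∧ Admissible w ∧ j ≤ s ∧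
    x = word (w ++ List.replicate j 1)}

theorem word_mem_trailingSpan {s j : ℕ} {w : Index} (hw : w ≠ []) (ha : Admissible w)
    (hj : j ≤ s) : word (w ++ List.replicate j 1) ∈ trailingSpan s :=
  Submodule.subset_span ⟨w, j, hw, ha, hj, rfl⟩

theorem trailingSpan_mono {s t : ℕ} (h : s ≤ t) : trailingSpan s ≤ trailingSpan t := by
  refine Submodule.span_mono ?_
  rintro x ⟨w, j, h1, h2, h3, h4⟩
  exact ⟨w, j, h1, h2, h3.trans h, h4⟩

theorem admissible_cons {a b : ℕ+} {w : Index} : Admissible (a :: b :: w) ↔ Admissible (b :: w) := by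
  simp [Admissible, List.getLast?_cons_cons]

theorem admissible_cons_of_ne_nil {a : ℕ+} {w : Index} (hw : w ≠ []) :
    Admissible (a :: w) ↔ Admissible w := by
  cases w with
  | nil => exact absurd rfl hw
  | cons b w => exact admissible_cons

/-- The admissible part is nonempty, so a letter in front does not affect its last letter. This is
why the span excludes the empty word there. -/
theorem consL_mem_trailingSpan (a : ℕ+) {s : ℕ} {x : H1} (hx : x ∈ trailingSpan s) :
    consL a x ∈ trailingSpan s := by
  have : trailingSpan s ≤ (trailingSpan s).comap (consL a) := by
    conv_lhs => rw [trailingSpan]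
    rw [Submodule.span_le]
    rintro x ⟨w, j, h1, h2, h3, rfl⟩
    show consL a _ ∈ trailingSpan s
    rw [consL_word, ← List.cons_append]
    exact word_mem_trailingSpan (by simp) ((admissible_cons_of_ne_nil h1).mpr h2) h3
  exact this hx

theorem admissible_one_add (b : ℕ+) : Admissible [1 + b] := by
  intro a ha
  simp only [List.getLast?_singleton, Option.mem_def, Option.some.injEq] at ha
  rw [← ha, ← PNat.coe_le_coe, PNat.add_coe, PNat.one_coe]
  have := b.pos
  show 2 ≤ 1 + (b : ℕ)
  omega

theorem harmWord_one_replicate (s : ℕ) :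
    harmWord [1] (List.replicate s 1) - ((s : ℚ) + 1) • word (List.replicate (s + 1) 1) ∈
      trailingSpan s := by
  induction s with
  | zero => simp [harmWord_nil_right]
  | succ s ih =>
    rw [List.replicate_succ, harmWord_cons_cons, harmWord_nil_left, harmWord_nil_left]
    have h1 := consL_mem_trailingSpan 1 (trailingSpan_mono (Nat.le_succ s) ih)
    have h2 : consL (1 + 1) (word (List.replicate s 1)) ∈ trailingSpan (s + 1) := by
      rw [consL_word]
      exact word_mem_trailingSpan (List.cons_ne_nil (1 + 1) []) (admissible_one_add 1)
        (Nat.le_succ s)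
    convert add_mem h1 h2 using 1
    simp only [map_sub, map_smul, consL_word, ← List.replicate_succ]
    push_cast
    module

/-- There are s + 1 slots for e_1 after `w`, all giving the same word. Every other insertion or
merger leaves at most `s` trailing letters e_1. -/
theorem harmWord_one_append (w : Index) (hw : Admissible w) (s : ℕ) :
    harmWord [1] (w ++ List.replicate s 1) -
      ((s : ℚ) + 1) • word (w ++ List.replicate (s + 1) 1) ∈ trailingSpan s := by
  induction w with
  | nil => exact harmWord_one_replicate s
  | cons b w ih =>
    have hw' : Admissible w := by
      cases w with
      | nil => intro a ha; simp at ha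
      | cons c w => exact admissible_cons.mp hw
    have hbw : Admissible ((1 + b) :: w) := by
      cases w with
      | nil => exact admissible_one_add b
      | cons c w => exact admissible_cons.mpr hw'
    rw [List.cons_append, harmWord_cons_cons, harmWord_nil_left, harmWord_nil_left]
    have h1 := consL_mem_trailingSpan b (ih hw')
    have h2 : consL 1 (word (b :: (w ++ List.replicate s 1))) ∈ trailingSpan s :=
      consL_mem_trailingSpan 1 (word_mem_trailingSpan (List.cons_ne_nil b w) hw le_rfl)
    have h3 : consL (1 + b) (word (w ++ List.replicate s 1)) ∈ trailingSpan s := by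
      rw [consL_word]
      exact word_mem_trailingSpan (List.cons_ne_nil (1 + b) w) hbw le_rfl
    convert add_mem (add_mem h1 h2) h3 using 1
    simp only [map_sub, map_smul, consL_word, List.cons_append]
    abel

/-- Multiplication by e_1 preserves the range, so by the previous lemma the next word is reached
modulo words with fewer trailing e_1, after division by s + 1. -/
theorem word_append_mem_range (s : ℕ) : ∀ w : Index, Admissible w →
    word (w ++ List.replicate s 1) ∈ LinearMap.range recombine := by
  induction s using Nat.strong_induction_on with
  | _ s ih =>
    intro w hw
    cases s with
    | zero => simpa using word_mem_range hw
    | succ s =>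
      have h1 : trailingSpan s ≤ LinearMap.range recombine := by
        rw [trailingSpan, Submodule.span_le]
        rintro x ⟨v, j, -, hv, hj, rfl⟩
        exact ih j (by omega) v hv
      have h2 := harm_one_mem_range (ih s (by omega) w hw)
      rw [harm_word] at h2
      have h3 := sub_mem h2 (h1 (harmWord_one_append w hw s))
      rw [sub_sub_cancel] at h3
      have h4 := Submodule.smul_mem _ ((s : ℚ) + 1)⁻¹ h3
      rwa [smul_smul, inv_mul_cancel₀ (by positivity), one_smul] at h4

theorem exists_admissible_append (k : Index) :
    ∃ (w : Index) (s : ℕ), Admissible w ∧ k = w ++ List.replicate s 1 := by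
  induction k using List.reverseRecOn with
  | nil => exact ⟨[], 0, by intro a ha; simp at ha, rfl⟩
  | append_singleton k a ih =>
    by_cases ha : a = 1
    · obtain ⟨w, s, hw, rfl⟩ := ih
      exact ⟨w, s + 1, hw, by rw [ha, List.append_assoc, ← List.replicate_succ']⟩
    · refine ⟨k ++ [a], 0, ?_, by simp⟩
      intro b hb
      simp only [List.getLast?_append, List.getLast?_singleton, Option.some_or, Option.mem_def,
        Option.some.injEq] at hb
      rw [← hb]
      have h1 : (a : ℕ) ≠ 1 := fun h => ha (PNat.coe_eq_one_iff.mp h)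
      have h2 := a.pos
      rw [← PNat.coe_le_coe]
      show 2 ≤ (a : ℕ)
      omega

theorem word_mem_range_recombine (k : Index) : word k ∈ LinearMap.range recombine := by
  obtain ⟨w, s, hw, rfl⟩ := exists_admissible_append k
  exact word_append_mem_range s w hw

/-- Only existence of a decomposition is needed: whichever one is chosen, its zeroth term yields the
constant term in `regLim_zetaReg`. -/
theorem exists_regHarm_word (k : Index) : ∃ p : ℕ →₀ H0,
    (word k = p.sum fun i b => harm (b : H1) (e1Pow i)) ∧ regHarm (word k) = p 0 := by
  have h : ∃ p : ℕ →₀ H0, word k = p.sum fun i b => harm (b : H1) (e1Pow i) := by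
    obtain ⟨p, hp⟩ := word_mem_range_recombine k
    exact ⟨p, by rw [← hp, recombine_apply]⟩
  exact ⟨h.choose, h.choose_spec, by rw [regHarm, dif_pos h]⟩

/-! ### Truncated sums on the harmonic algebra -/

variable {R : Type*} [CommRing R] [Algebra ℚ R]

/-- The linear extension of `qsum s` to `𝔥¹`. -/
noncomputable def qsumLin (s : List R) : H1 →ₗ[ℚ] R := Finsupp.linearCombination ℚ (qsum s)

@[simp] theorem qsumLin_word (s : List R) (k : Index) : qsumLin s (word k) = qsum s k := by
  simp [qsumLin, word]

theorem qsumLin_nil_consL (a : ℕ+) (x : H1) : qsumLin ([] : List R) (consL a x) = 0 := by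
  induction x using H1.induction with
  | hw k => simp
  | hadd x y hx hy => rw [map_add, map_add, hx, hy, add_zero]
  | hsmul c x hx => rw [map_smul, map_smul, hx, smul_zero]

theorem qsumLin_cons_consL (y : R) (s : List R) (a : ℕ+) (x : H1) :
    qsumLin (y :: s) (consL a x) = qsumLin s (consL a x) + y ^ (a : ℕ) * qsumLin s x := by
  induction x using H1.induction with
  | hw k => simp [qsum_cons_cons]
  | hadd x y hx hy => simp only [map_add, hx, hy]; ring
  | hsmul c x hx => simp only [map_smul, hx, smul_add, mul_smul_comm]

/-- The recursion of the harmonic product is the one for multiplying truncated sums when a value is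
prepended. Arbitrary depth is needed for the products with powers of e_1. -/
theorem qsumLin_harmWord (s : List R) (v w : Index) :
    qsumLin s (harmWord v w) = qsum s v * qsum s w := by
  induction s generalizing v w with
  | nil =>
    match v, w with
    | [], w => simp [harmWord_nil_left]
    | a :: v, [] => simp [harmWord_nil_right]
    | a :: v, b :: w => simp [harmWord_cons_cons, qsumLin_nil_consL]
  | cons x s ih =>
    match v, w with
    | [], w => simp [harmWord_nil_left]
    | a :: v, [] => simp [harmWord_nil_right]
    | a :: v, b :: w =>
      have h := ih (a :: v) (b :: w)
      rw [harmWord_cons_cons] at h ⊢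
      simp only [map_add, qsumLin_cons_consL, ih, qsum_cons_cons, PNat.add_coe, pow_add] at h ⊢
      linear_combination h

theorem qsumLin_harm (s : List R) (x y : H1) :
    qsumLin s (harm x y) = qsumLin s x * qsumLin s y := by
  induction x using H1.induction with
  | hw v =>
    induction y using H1.induction with
    | hw w => rw [harm_word, qsumLin_harmWord, qsumLin_word, qsumLin_word]
    | hadd x y hx hy => simp only [map_add, hx, hy, mul_add]
    | hsmul c x hx => simp only [map_smul, hx, mul_smul_comm]
  | hadd x y hx hy => simp only [map_add, LinearMap.add_apply, hx, hy, add_mul]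
  | hsmul c x hx => simp only [map_smul, LinearMap.smul_apply, hx, smul_mul_assoc]

theorem qsumLin_e1Pow (s : List R) (i : ℕ) : qsumLin s (e1Pow i) = qsum s [1] ^ i := by
  induction i with
  | zero => simp [e1Pow]
  | succ i ih => rw [e1Pow, qsumLin_harm, ih, qsumLin_word, pow_succ']

end Harmonic

open Filter Topology

/-! ### Truncated multiple zeta values and their asymptotics -/

section Asymptotics

/-- The list `1, 1/2, …, 1/N`. -/
noncomputable def recipList (N : ℕ) : List ℝ := (List.range' 1 N).map fun n : ℕ => (n : ℝ)⁻¹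

/-- The harmonic numbers, as truncated zeta values. -/
noncomputable def harmNum (N : ℕ) : ℝ := qsum (recipList N) [1]

theorem recipList_succ (N : ℕ) : recipList (N + 1) = recipList N ++ [((N : ℝ) + 1)⁻¹] := by
  simp [recipList, List.range'_1_concat, add_comm]

theorem qsum_recipList_succ (N : ℕ) (k : Index) (a : ℕ+) :
    qsum (recipList (N + 1)) (k ++ [a]) =
      qsum (recipList N) (k ++ [a]) + ((N : ℝ) + 1)⁻¹ ^ (a : ℕ) * qsum (recipList N) k := by
  rw [recipList_succ, qsum_concat]

theorem qsum_recipList_eq_sum (N : ℕ) (k : Index) (a : ℕ+) :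
    qsum (recipList N) (k ++ [a]) =
      ∑ n ∈ Finset.range N, ((n : ℝ) + 1)⁻¹ ^ (a : ℕ) * qsum (recipList n) k := by
  induction N with
  | zero => cases k <;> simp [recipList]
  | succ N ih => rw [qsum_recipList_succ, Finset.sum_range_succ, ih]

theorem recipList_mem {N : ℕ} {x : ℝ} (hx : x ∈ recipList N) : 0 ≤ x ∧ x ≤ 1 := by
  simp only [recipList, List.mem_map, List.mem_range'_1] at hx
  obtain ⟨n, hn, rfl⟩ := hx
  exact ⟨by positivity, inv_le_one_of_one_le₀ (by exact_mod_cast hn.1)⟩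

theorem qsum_nonneg {s : List ℝ} (hs : ∀ x ∈ s, 0 ≤ x) (k : Index) : 0 ≤ qsum s k := by
  induction s generalizing k with
  | nil => cases k <;> simp
  | cons x s ih =>
    have h := ih fun y hy => hs y (List.mem_cons_of_mem _ hy)
    cases k with
    | nil => simp
    | cons a w =>
      rw [qsum_cons_cons]
      exact add_nonneg (h _) (mul_nonneg (pow_nonneg (hs x List.mem_cons_self) _) (h _))

theorem qsum_le_qsum_cons {x : ℝ} {s : List ℝ} (hs : ∀ y ∈ x :: s, 0 ≤ y) (k : Index) :
    qsum s k ≤ qsum (x :: s) k := by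
  cases k with
  | nil => simp
  | cons a w =>
    rw [qsum_cons_cons]
    exact le_add_of_nonneg_right (mul_nonneg (pow_nonneg (hs x List.mem_cons_self) _)
      (qsum_nonneg (fun y hy => hs y (List.mem_cons_of_mem _ hy)) _))

/-- Drop the order condition on the first value and use x^a ≤ x on [0, 1]. -/
theorem qsum_cons_le {s : List ℝ} (hs : ∀ x ∈ s, 0 ≤ x ∧ x ≤ 1) (a : ℕ+) (w : Index) :
    qsum s (a :: w) ≤ qsum s [1] * qsum s w := by
  induction s with
  | nil => simp
  | cons x s ih =>
    have hs' : ∀ y ∈ s, 0 ≤ y ∧ y ≤ 1 := fun y hy => hs y (List.mem_cons_of_mem _ hy)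
    have hx := hs x List.mem_cons_self
    have h0 := qsum_nonneg (fun y hy => (hs' y hy).1) w
    have h1 := qsum_nonneg (fun y hy => (hs' y hy).1) [1]
    have h2 : x ^ (a : ℕ) ≤ x := pow_le_of_le_one hx.1 hx.2 a.ne_zero
    calc qsum (x :: s) (a :: w) = qsum s (a :: w) + x ^ (a : ℕ) * qsum s w := rfl
      _ ≤ qsum s [1] * qsum s w + x * qsum s w :=
        add_le_add (ih hs') (mul_le_mul_of_nonneg_right h2 h0)
      _ = qsum (x :: s) [1] * qsum s w := by rw [qsum_cons_cons]; simp; ring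
      _ ≤ qsum (x :: s) [1] * qsum (x :: s) w :=
        mul_le_mul_of_nonneg_left (qsum_le_qsum_cons (fun y hy => (hs y hy).1) w)
          (qsum_nonneg (fun y hy => (hs y hy).1) _)

theorem qsum_recipList_nonneg (N : ℕ) (k : Index) : 0 ≤ qsum (recipList N) k :=
  qsum_nonneg (fun _ hx => (recipList_mem hx).1) k

theorem qsum_recipList_le (N : ℕ) (k : Index) :
    qsum (recipList N) k ≤ harmNum N ^ k.length := by
  induction k with
  | nil => simp
  | cons a w ih =>
    rw [List.length_cons, pow_succ']
    exact (qsum_cons_le (fun _ hx => recipList_mem hx) a w).trans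
      (mul_le_mul_of_nonneg_left ih (qsum_recipList_nonneg N [1]))

theorem harmNum_nonneg (N : ℕ) : 0 ≤ harmNum N := qsum_recipList_nonneg N [1]

theorem harmNum_eq_sum (N : ℕ) : harmNum N = ∑ n ∈ Finset.range N, ((n : ℝ) + 1)⁻¹ := by
  have := qsum_recipList_eq_sum N [] 1
  simpa [harmNum] using this

theorem harmNum_mono : Monotone harmNum := by
  refine monotone_nat_of_le_succ fun N => ?_
  rw [harmNum_eq_sum, harmNum_eq_sum, Finset.sum_range_succ]
  exact le_add_of_nonneg_right (by positivity)

theorem tendsto_harmNum : Tendsto harmNum atTop atTop := by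
  have := Real.tendsto_sum_range_one_div_nat_succ_atTop
  simpa only [one_div, ← harmNum_eq_sum] using this

theorem harmNum_le (N : ℕ) : harmNum N ≤ 1 + Real.log N := by
  have := harmonic_le_one_add_log N
  rw [harmonic] at this
  push_cast at this
  rwa [harmNum_eq_sum]

theorem harmNum_pow_le (p : ℕ) : ∃ C : ℝ, ∀ n : ℕ, 1 ≤ n →
    harmNum n ^ p ≤ C * (n : ℝ) ^ (1 / 2 : ℝ) := by
  -- Chosen so that ε p ≤ 1/2; the growth n^(1/2) leaves the summable bound n^(-3/2) after
  -- multiplication by n^(-2).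
  set ε : ℝ := 1 / (2 * (p + 1)) with hε
  have hε0 : 0 < ε := by positivity
  refine ⟨(1 + 1 / ε) ^ p, fun n hn => ?_⟩
  have hn' : (1 : ℝ) ≤ n := by exact_mod_cast hn
  have h1 : harmNum n ≤ (1 + 1 / ε) * (n : ℝ) ^ ε := by
    have h2 := Real.log_le_rpow_div (by positivity : (0 : ℝ) ≤ n) hε0
    have h3 : (1 : ℝ) ≤ (n : ℝ) ^ ε := Real.one_le_rpow hn' hε0.le
    calc harmNum n ≤ 1 + Real.log n := harmNum_le n
      _ ≤ (n : ℝ) ^ ε + (n : ℝ) ^ ε / ε := add_le_add h3 h2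
      _ = _ := by ring
  calc harmNum n ^ p ≤ ((1 + 1 / ε) * (n : ℝ) ^ ε) ^ p :=
        pow_le_pow_left₀ (harmNum_nonneg n) h1 p
    _ = (1 + 1 / ε) ^ p * (n : ℝ) ^ (ε * p) := by
        rw [mul_pow, ← Real.rpow_mul_natCast (by positivity)]
    _ ≤ (1 + 1 / ε) ^ p * (n : ℝ) ^ (1 / 2 : ℝ) := by
        refine mul_le_mul_of_nonneg_left (Real.rpow_le_rpow_of_exponent_le hn' ?_)
          (by positivity)
        rw [hε, div_mul_eq_mul_div, div_le_div_iff₀ (by positivity) (by positivity)]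
        nlinarith

theorem summable_harmNum_pow (p : ℕ) :
    Summable fun n : ℕ => ((n : ℝ) + 1)⁻¹ ^ 2 * harmNum (n + 1) ^ p := by
  obtain ⟨C, hC⟩ := harmNum_pow_le p
  have h1 : Summable fun n : ℕ => C * ((n + 1 : ℕ) : ℝ) ^ (-(3 / 2) : ℝ) :=
    (((summable_nat_add_iff 1).mpr
      (Real.summable_nat_rpow.mpr (by norm_num : (-(3 / 2) : ℝ) < -1)))).mul_left C
  refine Summable.of_nonneg_of_le (fun n => ?_) (fun n => ?_) h1
  · have := harmNum_nonneg (n + 1)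
    positivity
  · have h2 := hC (n + 1) (by omega)
    have h3 : (0 : ℝ) < (n + 1 : ℕ) := by positivity
    have h4 : ((n : ℝ) + 1)⁻¹ ^ 2 = ((n + 1 : ℕ) : ℝ) ^ (-2 : ℝ) := by
      rw [Real.rpow_neg h3.le, inv_pow]
      norm_cast
    calc ((n : ℝ) + 1)⁻¹ ^ 2 * harmNum (n + 1) ^ p
        ≤ ((n + 1 : ℕ) : ℝ) ^ (-2 : ℝ) * (C * ((n + 1 : ℕ) : ℝ) ^ (1 / 2 : ℝ)) := by
          rw [h4]
          exact mul_le_mul_of_nonneg_left h2 (by positivity)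
      _ = C * (((n + 1 : ℕ) : ℝ) ^ (-2 : ℝ) * ((n + 1 : ℕ) : ℝ) ^ (1 / 2 : ℝ)) := by ring
      _ = _ := by
          rw [← Real.rpow_add h3]
          norm_num

/-! ### Convergence of truncated sums to multiple zeta values -/

/-- The increments of the truncated sums of an index with last entry `a`. -/
noncomputable def recipTerm (k : Index) (a : ℕ+) (n : ℕ) : ℝ :=
  ((n : ℝ) + 1)⁻¹ ^ (a : ℕ) * qsum (recipList n) k

theorem recipTerm_nonneg (k : Index) (a : ℕ+) (n : ℕ) : 0 ≤ recipTerm k a n :=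
  mul_nonneg (by positivity) (qsum_recipList_nonneg n k)

theorem recipTerm_le (k : Index) {a : ℕ+} (ha : 2 ≤ a) (n : ℕ) :
    recipTerm k a n ≤ ((n : ℝ) + 1)⁻¹ ^ 2 * harmNum (n + 1) ^ k.length := by
  refine mul_le_mul ?_ ?_ (qsum_recipList_nonneg n k) (by positivity)
  · exact pow_le_pow_of_le_one (by positivity)
      (inv_le_one_of_one_le₀ (by linarith [(Nat.cast_nonneg n : (0 : ℝ) ≤ n)]))
      (PNat.coe_le_coe _ _ |>.mpr ha)
  · exact (qsum_recipList_le n k).trans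
      (pow_le_pow_left₀ (harmNum_nonneg n) (harmNum_mono (Nat.le_succ n)) _)

theorem summable_recipTerm (k : Index) {a : ℕ+} (ha : 2 ≤ a) : Summable (recipTerm k a) :=
  Summable.of_nonneg_of_le (recipTerm_nonneg k a) (recipTerm_le k ha)
    (summable_harmNum_pow k.length)

/-- `zeta` is an unordered sum. Its terms are nonnegative and the tuples bounded by `N` exhaust the
index set, so bounded truncations give summability and the same value. -/
theorem zeta_eq_of_tendsto (k : Index) {L : ℝ}
    (hL : Tendsto (fun N => qsum (recipList N) k) atTop (𝓝 L))
    (hle : ∀ N, qsum (recipList N) k ≤ L) : zeta k = L := by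
  classical
  let T := {n : Fin k.length → ℕ // StrictMono n ∧ ∀ i, 0 < n i}
  let f : T → ℝ := fun n => ∏ i : Fin k.length, ((n.1 i : ℝ) ^ (k.get i : ℕ))⁻¹
  let F : ℕ → Finset T := fun N => (strictTuples k.length 1 N).subtype _
  have hF : ∀ N (n : T), n ∈ F N ↔ ∀ i, n.1 i ≤ N := by
    intro N n
    rw [show n ∈ F N ↔ n.1 ∈ strictTuples k.length 1 N from Finset.mem_subtype, mem_strictTuples]
    constructor
    · intro h i
      have := (h.1 i).2
      omega
    · intro h
      exact ⟨fun i => ⟨n.2.2 i, by have := h i; omega⟩, n.2.1⟩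
  have hsum : ∀ N, ∑ n ∈ F N, f n = qsum (recipList N) k := by
    intro N
    rw [recipList, ← sum_strictTuples, ← Finset.sum_subtype_of_mem (p := fun n : Fin k.length → ℕ =>
      StrictMono n ∧ ∀ i, 0 < n i)]
    · refine Finset.sum_congr rfl fun n _ => ?_
      simp [f, tupleTerm, inv_pow]
    · intro n hn
      have := mem_strictTuples.mp hn
      exact ⟨this.2, fun i => (this.1 i).1⟩
  have htend : Tendsto F atTop atTop := by
    refine tendsto_atTop_finset_of_monotone ?_ ?_
    · intro M N h n hn
      rw [hF] at hn ⊢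
      exact fun i => (hn i).trans h
    · intro n
      refine ⟨∑ i, n.1 i, (hF _ _).mpr fun i => ?_⟩
      exact Finset.single_le_sum (f := n.1) (fun _ _ => Nat.zero_le _) (Finset.mem_univ i)
  have hf : ∀ n, 0 ≤ f n := fun n => Finset.prod_nonneg fun i _ => by positivity
  have hs : Summable f := by
    refine summable_of_sum_le hf (c := L) fun u => ?_
    obtain ⟨N, hN⟩ := (htend.eventually (eventually_ge_atTop u)).exists
    exact (Finset.sum_le_sum_of_subset_of_nonneg hN fun n _ _ => hf n).trans
      ((hsum N).le.trans (hle N))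
  have h1 : Tendsto (fun N => ∑ n ∈ F N, f n) atTop (𝓝 (zeta k)) := hs.hasSum.comp htend
  simp only [hsum] at h1
  exact tendsto_nhds_unique h1 hL

theorem zeta_append (k : Index) {a : ℕ+} (ha : 2 ≤ a) :
    zeta (k ++ [a]) = ∑' n, recipTerm k a n := by
  have hs := summable_recipTerm k ha
  refine zeta_eq_of_tendsto _ ?_ fun N => ?_
  · simp only [qsum_recipList_eq_sum]
    exact hs.hasSum.tendsto_sum_nat
  · rw [qsum_recipList_eq_sum]
    exact hs.sum_le_tsum _ fun n _ => recipTerm_nonneg k a n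

theorem zeta_nil : zeta [] = 1 :=
  zeta_eq_of_tendsto [] (by simp) (by simp)

/-- In the tail beyond `N`, monotonicity allows the factor H_N^p to move inside the sum, where it is
absorbed by a convergent series. -/
theorem tendsto_tail_mul_harmNum_pow (k : Index) {a : ℕ+} (ha : 2 ≤ a) (p : ℕ) :
    Tendsto (fun N => (zeta (k ++ [a]) - qsum (recipList N) (k ++ [a])) * harmNum N ^ p)
      atTop (𝓝 0) := by
  have hs := summable_recipTerm k ha
  have hu := summable_harmNum_pow (k.length + p)
  have htail : ∀ N, zeta (k ++ [a]) - qsum (recipList N) (k ++ [a]) =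
      ∑' i, recipTerm k a (i + N) := by
    intro N
    rw [zeta_append k ha, qsum_recipList_eq_sum, ← hs.sum_add_tsum_nat_add N]
    exact add_sub_cancel_left _ _
  refine squeeze_zero (fun N => ?_) (fun N => ?_) (tendsto_sum_nat_add
    fun n : ℕ => ((n : ℝ) + 1)⁻¹ ^ 2 * harmNum (n + 1) ^ (k.length + p))
  · rw [htail]
    exact mul_nonneg (tsum_nonneg fun i => recipTerm_nonneg _ _ _)
      (pow_nonneg (harmNum_nonneg N) p)
  · rw [htail, ← tsum_mul_right]
    refine Summable.tsum_le_tsum (fun i => ?_) (((summable_nat_add_iff N).mpr hs).mul_right _)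
      ((summable_nat_add_iff N).mpr hu)
    rw [pow_add, ← mul_assoc]
    refine mul_le_mul (recipTerm_le k ha (i + N)) ?_ (pow_nonneg (harmNum_nonneg N) p) ?_
    · exact pow_le_pow_left₀ (harmNum_nonneg N) (harmNum_mono (by omega)) p
    · have := harmNum_nonneg (i + N + 1)
      positivity

/-! ### Regularized limits -/

/-- `x N` is asymptotically a polynomial in the harmonic numbers with constant term `c`, up to an
error that decays faster than any power of the harmonic numbers. -/
def RegLim (x : ℕ → ℝ) (c : ℝ) : Prop :=
  ∃ P : Polynomial ℝ, P.eval 0 = c ∧ ∀ Q : Polynomial ℝ,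
    Tendsto (fun N => (x N - P.eval (harmNum N)) * Q.eval (harmNum N)) atTop (𝓝 0)

theorem regLim_polynomial (P : Polynomial ℝ) :
    RegLim (fun N => P.eval (harmNum N)) (P.eval 0) :=
  ⟨P, rfl, fun Q => by simp⟩

theorem regLim_const (c : ℝ) : RegLim (fun _ => c) c := by
  simpa using regLim_polynomial (Polynomial.C c)

theorem RegLim.add {x y : ℕ → ℝ} {c d : ℝ} (hx : RegLim x c) (hy : RegLim y d) :
    RegLim (fun N => x N + y N) (c + d) := by
  obtain ⟨P, rfl, hP⟩ := hx
  obtain ⟨P', rfl, hP'⟩ := hy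
  refine ⟨P + P', by simp, fun Q => ?_⟩
  have := (hP Q).add (hP' Q)
  rw [add_zero] at this
  refine this.congr fun N => ?_
  simp only [Polynomial.eval_add]
  ring

/-- Write xy - PP' = (x-P)(y-P') + (x-P)P' + (y-P')P. The polynomial factors are harmless because
the error beats every polynomial `Q`. -/
theorem RegLim.mul {x y : ℕ → ℝ} {c d : ℝ} (hx : RegLim x c) (hy : RegLim y d) :
    RegLim (fun N => x N * y N) (c * d) := by
  obtain ⟨P, rfl, hP⟩ := hx
  obtain ⟨P', rfl, hP'⟩ := hy
  refine ⟨P * P', by simp, fun Q => ?_⟩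
  have := (((hP 1).mul (hP' Q)).add (hP (P' * Q))).add (hP' (P * Q))
  simp only [mul_zero, add_zero] at this
  refine this.congr fun N => ?_
  simp only [Polynomial.eval_mul, Polynomial.eval_one]
  ring

theorem RegLim.const_mul {x : ℕ → ℝ} {c : ℝ} (a : ℝ) (hx : RegLim x c) :
    RegLim (fun N => a * x N) (a * c) := (regLim_const a).mul hx

theorem RegLim.sum {ι : Type*} {s : Finset ι} {x : ι → ℕ → ℝ} {c : ι → ℝ}
    (h : ∀ i ∈ s, RegLim (x i) (c i)) : RegLim (fun N => ∑ i ∈ s, x i N) (∑ i ∈ s, c i) := by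
  classical
  induction s using Finset.induction_on with
  | empty => simpa using regLim_const 0
  | insert i s hi ih =>
    simp only [Finset.sum_insert hi]
    exact (h i (Finset.mem_insert_self i s)).add
      (ih fun j hj => h j (Finset.mem_insert_of_mem hj))

/-- The difference of the two polynomials tends to 0 along H_N → ∞, so it is constant and equal to
0. -/
theorem RegLim.unique {x : ℕ → ℝ} {c d : ℝ} (hc : RegLim x c) (hd : RegLim x d) : c = d := by
  obtain ⟨P, rfl, hP⟩ := hc
  obtain ⟨P', rfl, hP'⟩ := hd
  have h1 : Tendsto (fun N => (P' - P).eval (harmNum N)) atTop (𝓝 0) := by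
    have := (hP 1).sub (hP' 1)
    rw [sub_zero] at this
    refine this.congr fun N => ?_
    simp only [Polynomial.eval_one, Polynomial.eval_sub]
    ring
  have h2 : ¬ 0 < (P' - P).degree := by
    intro h
    have h3 := (Polynomial.abs_tendsto_atTop _ h).comp tendsto_harmNum
    exact not_tendsto_nhds_of_tendsto_atTop h3 _ h1.abs
  have h3 := Polynomial.eq_C_of_degree_le_zero (not_lt.mp h2)
  rw [h3] at h1
  simp only [Polynomial.eval_C] at h1
  have h4 := tendsto_nhds_unique h1 tendsto_const_nhds
  have h5 : (P' - P).eval 0 = 0 := by rw [← Polynomial.coeff_zero_eq_eval_zero, ← h4]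
  rw [Polynomial.eval_sub] at h5
  linarith

theorem regLim_harmNum_pow (i : ℕ) : RegLim (fun N => harmNum N ^ i) (0 ^ i) := by
  simpa using regLim_polynomial (Polynomial.X ^ i)

theorem regLim_qsum_of_admissible {k : Index} (hk : Admissible k) :
    RegLim (fun N => qsum (recipList N) k) (zeta k) := by
  rcases k.eq_nil_or_concat with rfl | ⟨v, a, rfl⟩
  · simpa [zeta_nil] using regLim_const 1
  · rw [List.concat_eq_append] at *
    have ha : 2 ≤ a := hk a (by simp)
    refine ⟨Polynomial.C (zeta (v ++ [a])), by simp, fun Q => ?_⟩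
    induction Q using Polynomial.induction_on' with
    | add p q hp hq =>
      have := hp.add hq
      rw [add_zero] at this
      refine this.congr fun N => ?_
      simp only [Polynomial.eval_add]
      ring
    | monomial n b =>
      have := (tendsto_tail_mul_harmNum_pow v ha n).const_mul (-b)
      rw [mul_zero] at this
      refine this.congr fun N => ?_
      simp only [Polynomial.eval_C, Polynomial.eval_monomial]
      ring

theorem regLim_qsumLin (b : H0) :
    RegLim (fun N => qsumLin (recipList N) (b : H1)) (evalH0 b : ℝ) := by
  obtain ⟨f, rfl⟩ := (Finsupp.supportedEquivFinsupp {k : Index | Admissible k}).symm.surjective b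
  induction f using Finsupp.induction_linear with
  | zero => simpa using regLim_const 0
  | add f g hf hg =>
    simp only [map_add, Submodule.coe_add, Subalgebra.coe_add]
    exact hf.add hg
  | single k c =>
    have h1 : (((Finsupp.supportedEquivFinsupp {k : Index | Admissible k}).symm
        (Finsupp.single k c) : H0) : H1) = c • word k.1 := by
      simp [word]
    have h2 : ((evalH0 ((Finsupp.supportedEquivFinsupp {k : Index | Admissible k}).symm
        (Finsupp.single k c)) : MZVAlg) : ℝ) = (c : ℝ) * zeta k.1 := by
      simp [evalH0, zetaZ, Algebra.smul_def]
    rw [h2]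
    simp only [h1, map_smul, qsumLin_word, Algebra.smul_def]
    exact (regLim_qsum_of_admissible k.2).const_mul _

/-- Truncation turns Σ a_i * e_1^{*i} into a sum of truncations of a_i times H_N^i. The truncation
of a_i has limit Z(a_i), so the constant term is Z(a_0). -/
theorem regLim_zetaReg (k : Index) :
    RegLim (fun N => qsum (recipList N) k) (zetaReg k : ℝ) := by
  obtain ⟨p, hp, hreg⟩ := exists_regHarm_word k
  -- The index 0 is added to the support because `p 0` may vanish.
  have h1 : ∀ N, qsum (recipList N) k =
      ∑ i ∈ insert 0 p.support, qsumLin (recipList N) (p i : H1) * harmNum N ^ i := by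
    intro N
    rw [← qsumLin_word, hp, Finsupp.sum_of_support_subset p (Finset.subset_insert 0 _) _ (by simp),
      map_sum]
    exact Finset.sum_congr rfl fun i _ => by rw [qsumLin_harm, qsumLin_e1Pow]; rfl
  have h2 : (zetaReg k : ℝ) = ∑ i ∈ insert 0 p.support, (evalH0 (p i) : ℝ) * 0 ^ i := by
    rw [zetaReg, hreg, Finset.sum_eq_single 0]
    · simp
    · intro i _ hi
      simp [hi]
    · simp
  rw [h2]
  simp only [h1]
  exact RegLim.sum fun i _ => (regLim_qsumLin (p i)).mul (regLim_harmNum_pow i)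

end Asymptotics
/-! ### The shifted series as truncated sums of power series -/

section Shifted

theorem sum_antidiagonalTuple_succ {M : Type*} [AddCommMonoid M] (n m : ℕ)
    (F : (Fin (n + 1) → ℕ) → M) :
    ∑ l ∈ Finset.Nat.antidiagonalTuple (n + 1) m, F l =
      ∑ q ∈ Finset.HasAntidiagonal.antidiagonal m, ∑ l ∈ Finset.Nat.antidiagonalTuple n q.2, F (Fin.cons q.1 l) := by
  rw [Finset.sum_sigma']
  refine Finset.sum_bij' (fun l _ => ⟨(l 0, ∑ i, Fin.tail l i), Fin.tail l⟩)
    (fun q _ => Fin.cons q.1.1 q.2) ?_ ?_ ?_ ?_ ?_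
  · intro l hl
    rw [Finset.Nat.mem_antidiagonalTuple, Fin.sum_univ_succ] at hl
    simp only [Finset.mem_sigma, Finset.HasAntidiagonal.mem_antidiagonal, Finset.Nat.mem_antidiagonalTuple]
    exact ⟨hl, trivial⟩
  · rintro ⟨⟨i, j⟩, l⟩ h
    simp only [Finset.mem_sigma, Finset.HasAntidiagonal.mem_antidiagonal, Finset.Nat.mem_antidiagonalTuple] at h
    rw [Finset.Nat.mem_antidiagonalTuple, Fin.sum_univ_succ]
    simpa [h.2] using h.1
  · intro l _
    exact Fin.cons_self_tail l
  · rintro ⟨⟨i, j⟩, l⟩ h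
    simp only [Finset.mem_sigma, Finset.HasAntidiagonal.mem_antidiagonal, Finset.Nat.mem_antidiagonalTuple] at h
    simp [h.2]
  · intro l _
    rw [Fin.cons_self_tail]

variable {A : Type*} [CommRing A]

/-- The coefficient of `t^m` in the series attached to `k` and a function `F` on indices. -/
def shiftCoeff (F : Index → A) (k : Index) (m : ℕ) : A :=
  ∑ l ∈ Finset.Nat.antidiagonalTuple k.length m,
    ((∏ j, ((k.get j : ℕ) + l j - 1).choose (l j) : ℕ) : A) * F (shift k l)

/-- The positive integer `a + i`. -/
def shiftLetter (a : ℕ+) (i : ℕ) : ℕ+ := ⟨(a : ℕ) + i, Nat.add_pos_left a.pos _⟩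

theorem coe_shiftLetter (a : ℕ+) (i : ℕ) : (shiftLetter a i : ℕ) = a + i := rfl

theorem shift_cons (a : ℕ+) (w : Index) (i : ℕ) (l : Fin w.length → ℕ) :
    shift (a :: w) (Fin.cons i l : Fin (w.length + 1) → ℕ) =
      shiftLetter a i :: shift w l := by
  rw [shift, shift]
  exact List.ofFn_succ

theorem shiftCoeff_cons (F : Index → A) (a : ℕ+) (w : Index) (m : ℕ) :
    shiftCoeff F (a :: w) m = ∑ q ∈ Finset.HasAntidiagonal.antidiagonal m,
      (((a : ℕ) + q.1 - 1).choose q.1 : A) *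
        shiftCoeff (fun v => F (shiftLetter a q.1 :: v)) w q.2 := by
  rw [shiftCoeff]
  refine (sum_antidiagonalTuple_succ w.length m _).trans ?_
  refine Finset.sum_congr rfl fun q _ => ?_
  rw [shiftCoeff, Finset.mul_sum]
  refine Finset.sum_congr rfl fun l _ => ?_
  rw [shift_cons, ← mul_assoc, ← Nat.cast_mul]
  congr 2
  exact Fin.prod_univ_succ _

theorem shiftCoeff_nil_zero (F : Index → A) : shiftCoeff F [] 0 = F [] := by
  have : shift [] ![] = [] := List.ofFn_zero
  simp [shiftCoeff, this]

theorem shiftCoeff_nil_succ (F : Index → A) (m : ℕ) : shiftCoeff F [] (m + 1) = 0 := by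
  rw [shiftCoeff]
  exact Finset.sum_empty

theorem shiftCoeff_add (F G : Index → A) (k : Index) (m : ℕ) :
    shiftCoeff (fun v => F v + G v) k m = shiftCoeff F k m + shiftCoeff G k m := by
  simp only [shiftCoeff, mul_add, Finset.sum_add_distrib]

theorem shiftCoeff_mul_left (c : A) (F : Index → A) (k : Index) (m : ℕ) :
    shiftCoeff (fun v => c * F v) k m = c * shiftCoeff F k m := by
  simp only [shiftCoeff, Finset.mul_sum, mul_left_comm]

theorem coeff_shiftedSeries (k : Index) (m : ℕ) :
    PowerSeries.coeff m (shiftedSeries k) = shiftCoeff (fun v => zetaReg v.reverse) k m := by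
  rw [shiftedSeries, PowerSeries.coeff_mk, shiftCoeff]

/-- The power series `1 / (t - n)` for `x = 1 / n`. -/
noncomputable def shiftedRecip (x : A) : PowerSeries A :=
  PowerSeries.C (-x) * PowerSeries.rescale x (PowerSeries.mk 1)

/-- The negative binomial series of (-x)^a (1 - xt)^(-a). -/
theorem coeff_shiftedRecip_pow (x : A) (a : ℕ+) (m : ℕ) :
    PowerSeries.coeff m (shiftedRecip x ^ (a : ℕ)) =
      (-1) ^ (a : ℕ) * (((a : ℕ) + m - 1).choose m : A) * x ^ ((a : ℕ) + m) := by
  obtain ⟨d, hd⟩ : ∃ d, (a : ℕ) = d + 1 := ⟨a - 1, by have := a.pos; omega⟩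
  rw [hd, shiftedRecip, mul_pow, ← map_pow, ← map_pow, PowerSeries.mk_one_pow_eq_mk_choose_add,
    PowerSeries.coeff_C_mul, PowerSeries.coeff_rescale, PowerSeries.coeff_mk,
    show d + 1 + m - 1 = d + m by omega, Nat.choose_symm_add, neg_pow, pow_add x (d + 1) m]
  ring

/-- The sum of the entries of an index. -/
def weight (k : Index) : ℕ := (k.map fun a : ℕ+ => (a : ℕ)).sum

theorem weight_cons (a : ℕ+) (w : Index) : weight (a :: w) = a + weight w := by
  simp [weight]

/-- Expanding every factor 1/(t - n)^a produces the binomial coefficients and shifted exponents of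
the definition, with one sign (-1)^a per entry. -/
theorem coeff_qsum_shiftedRecip (s : List A) (k : Index) (m : ℕ) :
    PowerSeries.coeff m (qsum (s.map shiftedRecip) k) =
      (-1) ^ weight k * shiftCoeff (qsum s) k m := by
  induction s generalizing k m with
  | nil =>
    cases k with
    | nil => cases m <;> simp [shiftCoeff_nil_zero, shiftCoeff_nil_succ, weight]
    | cons a w =>
      simp only [List.map_nil, qsum_nil_cons, map_zero, shiftCoeff_cons]
      simp [shiftCoeff]
  | cons x s ih =>
    cases k with
    | nil =>
      cases m with
      | zero => simp [shiftCoeff_nil_zero, weight]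
      | succ m => simp [shiftCoeff_nil_succ, PowerSeries.coeff_one]
    | cons a w =>
      rw [List.map_cons, qsum_cons_cons, map_add, ih, PowerSeries.coeff_mul, shiftCoeff_cons,
        shiftCoeff_cons]
      simp only [qsum_cons_cons, shiftCoeff_add, shiftCoeff_mul_left, ih, coeff_shiftedRecip_pow,
        mul_add, Finset.sum_add_distrib, weight_cons, pow_add (-1 : A), coe_shiftLetter]
      congr 1
      rw [Finset.mul_sum]
      exact Finset.sum_congr rfl fun q _ => by ring

/-- In the second half of `seriesList` the n decrease, which accounts for the reversed index in
`shiftedSeries`. -/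
theorem qsum_reverse (s : List A) (k : Index) : qsum s.reverse k = qsum s k.reverse := by
  induction s generalizing k with
  | nil =>
    rcases k.eq_nil_or_concat with rfl | ⟨v, a, rfl⟩
    · simp
    · cases v <;> simp
  | cons x s ih =>
    rcases k.eq_nil_or_concat with rfl | ⟨v, a, rfl⟩
    · simp
    · rw [List.concat_eq_append, List.reverse_cons, qsum_concat, ih, ih, List.reverse_append,
        List.reverse_singleton, List.singleton_append, qsum_cons_cons]

end Shifted

/-! ### Regularized limits of power series -/

section Series

/-- Coefficientwise regularized limits. -/
def RegLimSeries (X : ℕ → PowerSeries ℝ) (F : PowerSeries ℝ) : Prop :=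
  ∀ m, RegLim (fun N => PowerSeries.coeff m (X N)) (PowerSeries.coeff m F)

theorem RegLimSeries.add {X Y : ℕ → PowerSeries ℝ} {F G : PowerSeries ℝ} (hX : RegLimSeries X F)
    (hY : RegLimSeries Y G) : RegLimSeries (fun N => X N + Y N) (F + G) := by
  intro m
  simpa only [map_add] using (hX m).add (hY m)

theorem RegLimSeries.mul {X Y : ℕ → PowerSeries ℝ} {F G : PowerSeries ℝ} (hX : RegLimSeries X F)
    (hY : RegLimSeries Y G) : RegLimSeries (fun N => X N * Y N) (F * G) := by
  intro m
  simp only [PowerSeries.coeff_mul]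
  exact RegLim.sum fun q _ => (hX q.1).mul (hY q.2)

theorem RegLimSeries.sum {ι : Type*} {s : Finset ι} {X : ι → ℕ → PowerSeries ℝ}
    {F : ι → PowerSeries ℝ} (h : ∀ i ∈ s, RegLimSeries (X i) (F i)) :
    RegLimSeries (fun N => ∑ i ∈ s, X i N) (∑ i ∈ s, F i) := by
  intro m
  simp only [map_sum]
  exact RegLim.sum fun i hi => h i hi m

theorem RegLim.C {x : ℕ → ℝ} {c : ℝ} (h : RegLim x c) :
    RegLimSeries (fun N => PowerSeries.C (x N)) (PowerSeries.C c) := by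
  intro m
  simp only [PowerSeries.coeff_C]
  split_ifs
  · exact h
  · exact regLim_const 0

theorem RegLimSeries.unique {X : ℕ → PowerSeries ℝ} {F G : PowerSeries ℝ}
    (hF : RegLimSeries X F) (hG : RegLimSeries X G) : F = G := by
  ext m
  exact (hF m).unique (hG m)

theorem regLimSeries_insertSum (a : ℕ+) {X : ℕ → Index → PowerSeries ℝ}
    {F : Index → PowerSeries ℝ} (h : ∀ k, RegLimSeries (fun N => X N k) (F k)) (k : Index) :
    RegLimSeries (fun N => insertSum 1 a (X N) k) (insertSum 1 a F k) := by
  induction k generalizing X F with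
  | nil => exact h [a]
  | cons b w ih =>
    simp only [insertSum_cons, one_mul]
    exact ((h _).add (h _)).add (ih fun v => h (b :: v))

/-! ### The symmetric values as regularized limits -/

/-- The lift of the `t`-adic symmetric multiple zeta value as a real power series. -/
noncomputable def zetaSHatReal (k : Index) : PowerSeries ℝ :=
  PowerSeries.map (MZVAlg.val : MZVAlg →+* ℝ) (zetaSHatLift k)

/-- The list `1, 1/2, …, 1/N, 1/(t - N), …, 1/(t - 1)`. -/
noncomputable def seriesList (N : ℕ) : List (PowerSeries ℝ) :=
  (recipList N).map PowerSeries.C ++ (recipList N).reverse.map shiftedRecip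

theorem regLimSeries_shiftedSeries (k : Index) :
    RegLimSeries (fun N => qsum ((recipList N).reverse.map shiftedRecip) k)
      (PowerSeries.C ((-1) ^ weight k) *
        PowerSeries.map (MZVAlg.val : MZVAlg →+* ℝ) (shiftedSeries k)) := by
  intro m
  simp only [coeff_qsum_shiftedRecip, PowerSeries.coeff_C_mul, PowerSeries.coeff_map,
    coeff_shiftedSeries]
  refine RegLim.const_mul _ ?_
  simp only [shiftCoeff, map_sum, map_mul, map_natCast]
  refine RegLim.sum fun l _ => RegLim.const_mul _ ?_
  simp only [qsum_reverse]
  exact regLim_zetaReg _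

/-- By `qsum_append`, the i-th term has the first i entries at values 1/n and the rest at 1/(t - n);
it converges to the i-th term of the definition. -/
theorem regLimSeries_zetaSHatReal (k : Index) :
    RegLimSeries (fun N => qsum (seriesList N) k) (zetaSHatReal k) := by
  have h1 : zetaSHatReal k = ∑ i ∈ Finset.range (k.length + 1),
      PowerSeries.C (zetaReg (k.take i) : ℝ) * (PowerSeries.C ((-1) ^ weight (k.drop i)) *
        PowerSeries.map (MZVAlg.val : MZVAlg →+* ℝ) (shiftedSeries (k.drop i))) := by
    rw [zetaSHatReal, zetaSHatLift, map_sum]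
    refine Finset.sum_congr rfl fun i _ => ?_
    rw [map_mul, PowerSeries.map_C, map_mul, map_pow, map_neg, map_one, map_mul, ← mul_assoc,
      mul_comm (PowerSeries.C (zetaReg (k.take i) : ℝ))]
    rfl
  rw [h1]
  simp only [seriesList, qsum_append, ← map_qsum]
  exact RegLimSeries.sum fun i _ => (regLim_zetaReg _).C.mul (regLimSeries_shiftedSeries _)

/-- At each finite `N` both sides are the same truncated quantity, so their regularized limits
agree. -/
theorem isStuffle_zetaSHatReal : IsStuffle zetaSHatReal := by
  intro a k
  refine ((regLimSeries_zetaSHatReal [a]).mul (regLimSeries_zetaSHatReal k)).unique ?_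
  simp only [isStuffle_qsum _ a k]
  exact regLimSeries_insertSum a regLimSeries_zetaSHatReal k

theorem map_val_injective :
    Function.Injective (PowerSeries.map (MZVAlg.val : MZVAlg →+* ℝ)) :=
  PowerSeries.map_injective _ Subtype.val_injective

theorem isStuffle_zetaSHatLift : IsStuffle zetaSHatLift := by
  intro a k
  apply map_val_injective
  rw [map_mul, map_insertSum, map_one]
  exact isStuffle_zetaSHatReal a k

theorem isStuffle_zetaSHat : IsStuffle zetaSHat :=
  isStuffle_zetaSHatLift.map
    (PowerSeries.map (Ideal.Quotient.mk (Ideal.span {zetaZ [2] admissible_two})))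

theorem isStuffle_zetaS (n : ℕ) : IsStuffle (zetaS n) :=
  IsStuffle.map (S := SRing n) isStuffle_zetaSHat (Ideal.Quotient.mk _)

theorem zetaSHatLift_nil : zetaSHatLift [] = 1 := by
  apply map_val_injective
  have := regLimSeries_zetaSHatReal []
  simp only [qsum_nil_right] at this
  rw [map_one]
  refine this.unique ?_
  simpa using (regLim_const 1).C

theorem zetaS_nil (n : ℕ) : zetaS n [] = 1 := by
  rw [zetaS, zetaSHat, zetaSHatLift_nil, map_one, map_one]

theorem zetaStarS_eq_starSum (n : ℕ) : zetaStarS n = starSum (zetaS n) := by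
  ext k
  exact map_starSum (Ideal.Quotient.mk _) zetaSHat k

end Series
end FMZV

theorem mainTheorem7 (n r : ℕ) (hn : 0 < n) (hr : 0 < r) (k : Fin r → ℕ+) :
    (∑ σ : Equiv.Perm (Fin r), FMZV.zetaA n (List.ofFn fun i => k (σ i)) =
      ∑ P : Finpartition (Finset.univ : Finset (Fin r)),
        (-1) ^ (r - P.parts.card) * (FMZV.partCoeff P : FMZV.ARing n) *
          FMZV.blockProd (FMZV.zetaA n) k P) ∧
    (∑ σ : Equiv.Perm (Fin r), FMZV.zetaStarA n (List.ofFn fun i => k (σ i)) =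
      ∑ P : Finpartition (Finset.univ : Finset (Fin r)),
        (FMZV.partCoeff P : FMZV.ARing n) * FMZV.blockProd (FMZV.zetaA n) k P) ∧
    (∑ σ : Equiv.Perm (Fin r), FMZV.zetaS n (List.ofFn fun i => k (σ i)) =
      ∑ P : Finpartition (Finset.univ : Finset (Fin r)),
        (-1) ^ (r - P.parts.card) * (FMZV.partCoeff P : FMZV.SRing n) *
          FMZV.blockProd (FMZV.zetaS n) k P) ∧
    (∑ σ : Equiv.Perm (Fin r), FMZV.zetaStarS n (List.ofFn fun i => k (σ i)) =
      ∑ P : Finpartition (Finset.univ : Finset (Fin r)),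
        (FMZV.partCoeff P : FMZV.SRing n) * FMZV.blockProd (FMZV.zetaS n) k P) := by
  rw [FMZV.zetaStarA_eq_starSum, FMZV.zetaStarS_eq_starSum]
  exact ⟨(FMZV.isStuffle_zetaA n).symmetric_sum (FMZV.zetaA_nil n) k,
    (FMZV.isStuffle_zetaA n).symmetric_starSum (FMZV.zetaA_nil n) k,
    (FMZV.isStuffle_zetaS n).symmetric_sum (FMZV.zetaS_nil n) k,
    (FMZV.isStuffle_zetaS n).symmetric_starSum (FMZV.zetaS_nil n) k⟩
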